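/- Let $(\Omega,\mu)$ be a $\sigma$-finite measure space, with functions complex-valued and identified if equal a.e. Write $\|\cdot\|_p$ for the $L^p(\Omega,\mu)$ norm. Let $L^0_\mu$ be the set of a.e. finite measurable $f$ with $\mu\{|f|>c\}<\infty$ for some $c>0$, and let $f^*(t)=\inf\{c>0:\mu\{|f|>c\}\le t\}$ be the non-increasing rearrangement of $f\in L^0_\mu$ (with $f^*(0)=\|f\|_\infty$). A fully symmetric space on $(0,\infty)$ (with Lebesgue measure $\nu$) is a non-zero linear subspace $E\subset L^0_\nu$ with a Banach norm such that $f\in E$, $g\in L^0_\nu$ and $\int_0^s g^*\,dt\le\int_0^s f^*\,dt$ for all $s>0$ imply $g\in E$ and $\|g\|_E\le\|f\|_E$. It generates the space $E(\Omega)=\{f\in L^0_\mu: f^*\in E\}$. A Dunford–Schwartz operator is a linear map $T:L^1+L^\infty\to L^1+L^\infty$ (over $(\Omega,\mu)$) with $\|Tf\|_1\le\|f\|_1$ for $f\in L^1$ and $\|Tf\|_\infty\le\|f\|_\infty$ for $f\in L^\infty$. A bounded Besicovitch sequence is a bounded sequence $(\beta_k)_{k\ge0}$ in $\mathbb C$ such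 that for every $\varepsilon>0$ there is a trigonometric polynomial $P(k)=\sum_{j=1}^s z_j\lambda_j^k$ ($z_j\in\mathbb C$, $|\lambda_j|=1$) with $\limsup_n\frac1n\sum_{k=0}^{n-1}|\beta_k-P(k)|<\varepsilon$. A sequence $f_n$ converges to $f$ almost uniformly (a.u.) if for every $\varepsilon>0$ there is a measurable $G\subset\Omega$ with $\mu(\Omega\setminus G)\le\varepsilon$ and $\|(f-f_n)\chi_G\|_\infty\to0$. **Theorem.** Let $E$ be a fully symmetric space on $(0,\infty)$ with $\mathbf 1=\chi_\Omega\notin E(\Omega)$. Then $E(\Omega)\subset L^1+L^\infty$, and for every bounded Besicovitch sequence $(\beta_k)$, every Dunford–Schwartz operator $T$ and every $f\in E(\Omega)$ the averages $$\frac1n\sum_{k=0}^{n-1}\beta_kT^k(f)$$ converge a.u. to some $\hat f\in E(\Omega)$. If $\mu(\Omega)=\infty$, the same conclusion holds with $E(\Omega)$ replaced by any of the following spaces. 1. The Orlicz space $\{f\in L^0_\mu:\int_\Omega\Phi(|f|/a)\,d\mu<\infty\text{ for some }a>0\}$, where $\Phi:[0,\infty)\to[0,\infty)$ is convex, continuous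 at $0$, $\Phi(0)=0$ and $\Phi(u)>0$ for $u>0$. 2. The Lorentz space $\{f\in L^0_\mu:\int_{[0,\infty)}f^*\,d\varphi<\infty\}$, where $\varphi$ is a non-decreasing concave function on $[0,\infty)$ with $\varphi(0)=0$, $\varphi(t)>0$ for some $t>0$, and $\lim_{t\to\infty}\varphi(t)=\infty$ (the Stieltjes measure $d\varphi$ has an atom of mass $\varphi(0+)$ at $0$). 3. The Marcinkiewicz space $\{f\in L^0_\mu:\sup_{s>0}\frac1{\varphi(s)}\int_0^sf^*(t)\,dt<\infty\}$, where $\varphi$ is a non-decreasing concave function on $[0,\infty)$ with $\varphi(0)=0$, $\varphi(t)>0$ for some $t>0$, and $\varphi(t)/t\to0$ as $t\to\infty$. -/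

import Mathlib

open MeasureTheory Filter Topology Set
open scoped ENNReal

namespace SymmErgodic

section MeasureSpace

variable {Ω : Type*} [MeasurableSpace Ω]

/-- The space `L¹ + L^∞` of (classes of) complex-valued measurable functions. -/
noncomputable def L1addLinf (μ : Measure Ω) : Submodule ℂ (Ω →ₘ[μ] ℂ) :=
  Lp.LpSubmodule ℂ ℂ 1 μ ⊔ Lp.LpSubmodule ℂ ℂ ∞ μ

/-- `L⁰_μ`: the (classes of) measurable functions `f` with `μ {|f| > c} < ∞` for some `c > 0`. -/
def L0fin (μ : Measure Ω) : Set (Ω →ₘ[μ] ℂ) :=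
  {f | ∃ c : ℝ, 0 < c ∧ μ {ω | c < ‖f ω‖} < ∞}

/-- The non-increasing rearrangement `f*(t) = inf {c > 0 : μ {|f| > c} ≤ t}`, with values in
`[0, ∞]`; it is finite for all `t > 0` when `f` belongs to `L0fin μ`. At `t = 0` it is the
essential supremum of `|f|`. -/
noncomputable def rearr (μ : Measure Ω) (f : Ω →ₘ[μ] ℂ) (t : ℝ) : ℝ≥0∞ :=
  sInf {c : ℝ≥0∞ | 0 < c ∧ μ {ω | c < ‖f ω‖ₑ} ≤ ENNReal.ofReal t}

theorem rearr_antitone (μ : Measure Ω) (f : Ω →ₘ[μ] ℂ) : Antitone (rearr μ f) := by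
  intro s t hst
  exact sInf_le_sInf fun c hc => ⟨hc.1, hc.2.trans (ENNReal.ofReal_le_ofReal hst)⟩

/-- Lebesgue measure on the half-line `(0, ∞)`. -/
noncomputable def halfLine : Measure ℝ := volume.restrict (Ioi 0)

theorem rearr_aestronglyMeasurable (μ : Measure Ω) (f : Ω →ₘ[μ] ℂ) :
    AEStronglyMeasurable (fun t : ℝ => ((rearr μ f t).toReal : ℂ)) halfLine :=
  (Complex.measurable_ofReal.comp
    (rearr_antitone μ f).measurable.ennreal_toReal).aestronglyMeasurable

/-- The non-increasing rearrangement of `f` as a (class of a) function on `(0, ∞)`. It is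
meaningful for `f` in `L0fin μ`. -/
noncomputable def rearrClass (μ : Measure Ω) (f : Ω →ₘ[μ] ℂ) : ℝ →ₘ[halfLine] ℂ :=
  AEEqFun.mk (fun t : ℝ => ((rearr μ f t).toReal : ℂ)) (rearr_aestronglyMeasurable μ f)

end MeasureSpace

/-- Submajorization `g ≺≺ f` of functions on `(0, ∞)`:
`∫₀ˢ g*(t) dt ≤ ∫₀ˢ f*(t) dt` for all `s > 0`. -/
def Submaj (g f : ℝ →ₘ[halfLine] ℂ) : Prop :=
  ∀ s : ℝ, 0 < s →
    ∫⁻ t in Ioc 0 s, rearr halfLine g t ≤ ∫⁻ t in Ioc 0 s, rearr halfLine f t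

/-- A fully symmetric space on `(0, ∞)`: a non-zero linear subspace of `L⁰_ν`, where `ν` is
Lebesgue measure on `(0, ∞)`, with a Banach norm, which is monotone under submajorization. -/
structure FullySymmetricSpace where
  carrier : Submodule ℂ (ℝ →ₘ[halfLine] ℂ)
  nonzero : carrier ≠ ⊥
  subset_L0fin : ∀ f ∈ carrier, f ∈ L0fin halfLine
  norm : Seminorm ℂ carrier
  eq_zero_of_norm : ∀ f : carrier, norm f = 0 → f = 0
  complete : ∀ u : ℕ → carrier,
    (∀ ε : ℝ, 0 < ε → ∃ N : ℕ, ∀ m ≥ N, ∀ n ≥ N, norm (u m - u n) < ε) →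
    ∃ f : carrier, Tendsto (fun n => norm (u n - f)) atTop (𝓝 0)
  fully_symm : ∀ (f : carrier) (g : ℝ →ₘ[halfLine] ℂ), g ∈ L0fin halfLine →
    Submaj g f → ∃ hg : g ∈ carrier, norm ⟨g, hg⟩ ≤ norm f

section MeasureSpace

variable {Ω : Type*} [MeasurableSpace Ω]

/-- The fully symmetric space `E(Ω, μ)` on `(Ω, μ)` generated by the fully symmetric space `E`
on `(0, ∞)`: all `f` in `L⁰_μ` with `f*` in `E`. -/
def FullySymmetricSpace.on (E : FullySymmetricSpace) (μ : Measure Ω) : Set (Ω →ₘ[μ] ℂ) :=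
  {f | f ∈ L0fin μ ∧ rearrClass μ f ∈ E.carrier}

/-- Dunford-Schwartz operators, acting on `L¹ + L^∞`: linear maps that are contractive for the
`L¹` norm on `L¹` and for the `L^∞` norm on `L^∞`. For `f` outside `L¹` (outside `L^∞`) the
right-hand side of the first (second) inequality is infinite, so that nothing is required. -/
def IsDunfordSchwartz (μ : Measure Ω) (T : Module.End ℂ (L1addLinf μ)) : Prop :=
  ∀ f : L1addLinf μ,
    eLpNorm (T f : Ω →ₘ[μ] ℂ) 1 μ ≤ eLpNorm (f : Ω →ₘ[μ] ℂ) 1 μ ∧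
    eLpNorm (T f : Ω →ₘ[μ] ℂ) ∞ μ ≤ eLpNorm (f : Ω →ₘ[μ] ℂ) ∞ μ

/-- Almost uniform convergence (in the sense of Egorov). -/
def TendstoAU (μ : Measure Ω) (u : ℕ → (Ω →ₘ[μ] ℂ)) (f : Ω →ₘ[μ] ℂ) : Prop :=
  ∀ ε : ℝ, 0 < ε → ∃ G : Set Ω, MeasurableSet G ∧ μ Gᶜ ≤ ENNReal.ofReal ε ∧
    Tendsto (fun n => eLpNorm (G.indicator fun ω => f ω - u n ω) ∞ μ) atTop (𝓝 0)

end MeasureSpace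

/-- Trigonometric polynomials `P(k) = ∑ⱼ zⱼ λⱼᵏ` with `|λⱼ| = 1`. -/
def IsTrigPoly (P : ℤ → ℂ) : Prop :=
  ∃ (s : ℕ) (z : Fin s → ℂ) (l : Fin s → Circle), ∀ k : ℤ, P k = ∑ j, z j * (l j : ℂ) ^ k

/-- Bounded Besicovitch sequences. -/
def IsBoundedBesicovitch (β : ℕ → ℂ) : Prop :=
  (∃ C : ℝ, ∀ k, ‖β k‖ ≤ C) ∧
  ∀ ε : ℝ, 0 < ε → ∃ P : ℤ → ℂ, IsTrigPoly P ∧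
    limsup (fun n : ℕ => (1 / (n : ℝ)) * ∑ k ∈ Finset.range n, ‖β k - P k‖) atTop < ε

section MeasureSpace

variable {Ω : Type*} [MeasurableSpace Ω]

/-- The weighted averages `Bₙ(f) = (1/n) ∑_{k < n} β_k Tᵏ f`. -/
noncomputable def weightedAvg (μ : Measure Ω) (T : Module.End ℂ (L1addLinf μ)) (β : ℕ → ℂ)
    (f : L1addLinf μ) (n : ℕ) : L1addLinf μ :=
  (1 / (n : ℂ)) • ∑ k ∈ Finset.range n, β k • (T ^ k) f

/-- The weighted ergodic theorem holds in the space `X` of functions: `X` lies in `L¹ + L^∞`, and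
for all Dunford-Schwartz operators `T`, all bounded Besicovitch sequences `β` and all `f` in `X`
the weighted averages converge almost uniformly to an element of `X`. -/
def WeightedErgodicTheoremHolds (μ : Measure Ω) (X : Set (Ω →ₘ[μ] ℂ)) : Prop :=
  ∀ β : ℕ → ℂ, IsBoundedBesicovitch β →
    ∀ T : Module.End ℂ (L1addLinf μ), IsDunfordSchwartz μ T →
      ∀ f ∈ X, ∃ hf : f ∈ L1addLinf μ, ∃ g ∈ X,
        TendstoAU μ (fun n => (weightedAvg μ T β ⟨f, hf⟩ n : Ω →ₘ[μ] ℂ)) g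

/-- Orlicz functions on `[0, ∞)` (values at negative reals are irrelevant). -/
structure IsOrliczFunction (Φ : ℝ → ℝ) : Prop where
  convex : ConvexOn ℝ (Ici 0) Φ
  cont : ContinuousWithinAt Φ (Ici 0) 0
  zero : Φ 0 = 0
  pos : ∀ u, 0 < u → 0 < Φ u

/-- The Orlicz space of `Φ`: all `f` in `L⁰_μ` with `∫ Φ(|f| / a) dμ < ∞` for some `a > 0`. -/
def orliczSpace (μ : Measure Ω) (Φ : ℝ → ℝ) : Set (Ω →ₘ[μ] ℂ) :=
  {f | f ∈ L0fin μ ∧ ∃ a : ℝ, 0 < a ∧ ∫⁻ ω, ENNReal.ofReal (Φ (a⁻¹ * ‖f ω‖)) ∂μ < ∞}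

/-- Increasing concave functions `φ` on `[0, ∞)` with `φ(0) = 0` and `φ(t) > 0` for some `t > 0`
(values at negative reals are irrelevant). -/
structure IsConcaveWeight (φ : ℝ → ℝ) : Prop where
  mono : MonotoneOn φ (Ici 0)
  concave : ConcaveOn ℝ (Ici 0) φ
  zero : φ 0 = 0
  pos : ∃ t, 0 < t ∧ 0 < φ t

theorem IsConcaveWeight.monotone_extend {φ : ℝ → ℝ} (h : IsConcaveWeight φ) :
    Monotone fun t : ℝ => φ (max t 0) := fun _ _ hst =>
  h.mono (mem_Ici.2 (le_max_right _ _)) (mem_Ici.2 (le_max_right _ _)) (max_le_max_right 0 hst)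

/-- The Lebesgue-Stieltjes measure `dφ` on `[0, ∞)`, with an atom of mass `φ(0+)` at `0`. -/
noncomputable def IsConcaveWeight.measure {φ : ℝ → ℝ} (h : IsConcaveWeight φ) : Measure ℝ :=
  h.monotone_extend.stieltjesFunction.measure

/-- The Lorentz space of `φ`: all `f` in `L⁰_μ` with `∫₀^∞ f* dφ < ∞`. -/
def lorentzSpace (μ : Measure Ω) {φ : ℝ → ℝ} (h : IsConcaveWeight φ) : Set (Ω →ₘ[μ] ℂ) :=
  {f | f ∈ L0fin μ ∧ ∫⁻ t, rearr μ f t ∂h.measure < ∞}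

/-- The Marcinkiewicz space of `φ`: all `f` in `L⁰_μ` with
`sup_{s > 0} φ(s)⁻¹ ∫₀ˢ f*(t) dt < ∞`. -/
def marcinkiewiczSpace (μ : Measure Ω) (φ : ℝ → ℝ) : Set (Ω →ₘ[μ] ℂ) :=
  {f | f ∈ L0fin μ ∧
    ⨆ s : Ioi (0 : ℝ), (ENNReal.ofReal (φ s))⁻¹ * ∫⁻ t in Ioc 0 (s : ℝ), rearr μ f t < ∞}

end MeasureSpace

end SymmErgodic

/-! Everything is measured by the tails `tail μ f c`, the integrals of `(|f| - c)⁺`. A function in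
one of the listed spaces has finite tails at every level `c > 0`. Each space is closed under
positive multiples and under passing to functions with finite tails whose tails are dominated by
those of a member. `weightedErgodicTheoremHolds_of` shows that these three properties suffice.

Convergence for functions with finite tails follows Banach's principle. The maximal inequality comes
from Chacon's filling scheme (`exists_filling`, `maximal_one`), which does not need `T` to be
positive and allows bounded weights; truncation at height `lam` turns its `L¹` form into one
governed by tails (`maximal`). The dense class is `L² ∩ L^∞`. By interpolation `T` contracts `L²`,
so by the mean ergodic theorem a bounded `x` in `L²` is, up to a small `L²` error, a fixed vector
plus a coboundary `y - T y` with `y` bounded, and the averages of such a sum converge uniformly.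
Applied to the Dunford–Schwartz operators `l • T` with `|l| = 1`, this covers the weights `l ^ k`,
hence trigonometric polynomials, hence bounded Besicovitch weights, since `x` is bounded. Cutting
out the part of `f` between a small and a large height reaches all functions with finite tails.

The limit stays in the space: splitting at a height shows that the tails of every average are at
most those of `C • f`, with `C` a bound of the weights, and Fatou's lemma passes this to the limit.

It remains to see that tail domination is respected. For rearrangements, `∫₀ˢ f*` is the minimum
over `c ≥ 0` of `tail f c + c s`, so tail domination gives submajorization; this settles fully
symmetric and Marcinkiewicz spaces. For Orlicz spaces, `Φ` is compared with the primitive of an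
increasing weight, and for Lorentz spaces `φ` is linearised by supergradients; both then rest on
Hardy's lemma `lintegral_mul_le_of_forall_Ioi`. -/

namespace SymmErgodic

/-! ### Radial truncation and tails. -/

section Truncation

variable {Ω : Type*} [MeasurableSpace Ω] {μ : Measure Ω}

/-- Subtraction on `L¹ + L^∞`, as a shortcut that keeps to the structure of a submodule. -/
noncomputable instance : Sub (L1addLinf μ) :=
  (Submodule.addCommGroup (L1addLinf μ)).toSubNegMonoid.toSub

/-- Radial truncation of a complex number at height `c`. -/
noncomputable def clip (c : ℝ) (z : ℂ) : ℂ := (min 1 (c / ‖z‖) : ℝ) • z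

theorem measurable_clip : Measurable (Function.uncurry clip) := by
  unfold clip Function.uncurry
  fun_prop

theorem norm_clip {c : ℝ} (hc : 0 ≤ c) (z : ℂ) : ‖clip c z‖ = min ‖z‖ c := by
  unfold clip
  rcases eq_or_ne z 0 with rfl | hz
  · simp [hc]
  have hz' : 0 < ‖z‖ := norm_pos_iff.2 hz
  rw [norm_smul, Real.norm_of_nonneg (le_min zero_le_one (by positivity)),
    min_mul_of_nonneg _ _ hz'.le, one_mul, div_mul_cancel₀ _ hz'.ne']

theorem norm_sub_clip {c : ℝ} (hc : 0 ≤ c) (z : ℂ) : ‖z - clip c z‖ = ‖z‖ - min ‖z‖ c := by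
  unfold clip
  rcases eq_or_ne z 0 with rfl | hz
  · simp [hc]
  have hz' : 0 < ‖z‖ := norm_pos_iff.2 hz
  have h1 : z - (min 1 (c / ‖z‖) : ℝ) • z = (1 - min 1 (c / ‖z‖) : ℝ) • z := by
    rw [sub_smul, one_smul]
  rw [h1, norm_smul, Real.norm_of_nonneg (sub_nonneg.2 (min_le_left _ _)), sub_mul,
    min_mul_of_nonneg _ _ hz'.le, one_mul, div_mul_cancel₀ _ hz'.ne']

/-- Truncation of a class of functions at a variable height. -/
noncomputable def clipClass (c : Ω →ₘ[μ] ℝ) (f : Ω →ₘ[μ] ℂ) : Ω →ₘ[μ] ℂ :=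
  AEEqFun.comp₂Measurable clip measurable_clip c f

theorem coeFn_clipClass (c : Ω →ₘ[μ] ℝ) (f : Ω →ₘ[μ] ℂ) :
    clipClass c f =ᵐ[μ] fun ω => clip (c ω) (f ω) :=
  AEEqFun.coeFn_comp₂Measurable _ _ _ _

/-- The integral of the part of `|f|` above the level `c`. -/
noncomputable def tail (μ : Measure Ω) (f : Ω →ₘ[μ] ℂ) (c : ℝ) : ℝ≥0∞ :=
  ∫⁻ ω, ENNReal.ofReal (‖f ω‖ - c) ∂μ

theorem tail_zero (f : Ω →ₘ[μ] ℂ) : tail μ f 0 = eLpNorm f 1 μ := by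
  simp [tail, eLpNorm_one_eq_lintegral_enorm]

theorem tail_le_of_norm_le {f g : Ω →ₘ[μ] ℂ} {a : ℝ} (h : ∀ᵐ ω ∂μ, ‖g ω‖ ≤ ‖f ω‖ + a) (c : ℝ) :
    tail μ g (c + a) ≤ tail μ f c :=
  lintegral_mono_ae <| h.mono fun _ h => ENNReal.ofReal_le_ofReal (by linarith)

theorem measurable_norm_coe (f : Ω →ₘ[μ] ℂ) : Measurable fun ω => ‖f ω‖ :=
  f.stronglyMeasurable.measurable.norm

theorem eLpNorm_top_le_iff {f : Ω → ℂ} {c : ℝ} (hc : 0 ≤ c) :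
    eLpNorm f ∞ μ ≤ ENNReal.ofReal c ↔ ∀ᵐ ω ∂μ, ‖f ω‖ ≤ c := by
  rw [eLpNorm_exponent_top]
  refine ⟨fun h => ?_, eLpNormEssSup_le_of_ae_bound⟩
  filter_upwards [ae_le_eLpNormEssSup (f := f) (μ := μ)] with ω hω
  have := hω.trans h
  rwa [← ofReal_norm, ENNReal.ofReal_le_ofReal_iff hc] at this

theorem coeFn_clipClass_const (c : ℝ) (f : Ω →ₘ[μ] ℂ) :
    ∀ᵐ ω ∂μ, clipClass (AEEqFun.const Ω c) f ω = clip c (f ω) := by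
  filter_upwards [coeFn_clipClass (AEEqFun.const Ω c) f, AEEqFun.coeFn_const (μ := μ) Ω c] with ω h1 h2
  rw [h1, h2]
  rfl

theorem mem_L1addLinf_of_eLpNorm_one {f : Ω →ₘ[μ] ℂ} (h : eLpNorm f 1 μ < ∞) :
    f ∈ L1addLinf μ :=
  Submodule.mem_sup_left (Lp.mem_Lp_iff_eLpNorm_lt_top.2 h)

theorem mem_L1addLinf_of_eLpNorm_top {f : Ω →ₘ[μ] ℂ} (h : eLpNorm f ∞ μ < ∞) :
    f ∈ L1addLinf μ :=
  Submodule.mem_sup_right (Lp.mem_Lp_iff_eLpNorm_lt_top.2 h)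

theorem eLpNorm_top_clip_le {c : ℝ} (hc : 0 ≤ c) (f : Ω →ₘ[μ] ℂ) :
    eLpNorm (clipClass (AEEqFun.const Ω c) f) ∞ μ ≤ ENNReal.ofReal c := by
  rw [eLpNorm_top_le_iff hc]
  filter_upwards [coeFn_clipClass_const c f] with ω h
  rw [h, norm_clip hc]
  exact min_le_right _ _

theorem eLpNorm_one_sub_clip {c : ℝ} (hc : 0 ≤ c) (f : Ω →ₘ[μ] ℂ) :
    eLpNorm (f - clipClass (AEEqFun.const Ω c) f : Ω →ₘ[μ] ℂ) 1 μ = tail μ f c := by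
  rw [eLpNorm_one_eq_lintegral_enorm]
  refine lintegral_congr_ae ?_
  filter_upwards [coeFn_clipClass_const c f, AEEqFun.coeFn_sub f (clipClass (AEEqFun.const Ω c) f)]
    with ω h h'
  rw [h', Pi.sub_apply, h, ← ofReal_norm, norm_sub_clip hc]
  rcases le_total ‖f ω‖ c with h | h
  · rw [min_eq_left h, sub_self, ENNReal.ofReal_zero, ENNReal.ofReal_of_nonpos (by linarith)]
  · rw [min_eq_right h]

/-- If `f = u + v` with `|v| ≤ c`, then `(|f| - c)⁺ ≤ |u|`. Conversely, truncation at height `c`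
leaves a remainder whose `L¹` norm is the tail. -/
theorem mem_L1addLinf_iff {f : Ω →ₘ[μ] ℂ} :
    f ∈ L1addLinf μ ↔ ∃ c : ℝ, 0 ≤ c ∧ tail μ f c < ∞ := by
  constructor
  · intro hf
    obtain ⟨u, hu, v, hv, rfl⟩ := Submodule.mem_sup.1 hf
    have hu' : eLpNorm u 1 μ < ∞ := Lp.mem_Lp_iff_eLpNorm_lt_top.1 hu
    have hv' : eLpNorm v ∞ μ < ∞ := Lp.mem_Lp_iff_eLpNorm_lt_top.1 hv
    refine ⟨(eLpNorm v ∞ μ).toReal, ENNReal.toReal_nonneg, ?_⟩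
    have hb := (eLpNorm_top_le_iff (f := v) (μ := μ) (c := (eLpNorm v ∞ μ).toReal)
      ENNReal.toReal_nonneg).1 (ENNReal.ofReal_toReal hv'.ne).ge
    have := tail_le_of_norm_le (f := u) (g := u + v) (a := (eLpNorm v ∞ μ).toReal) ?_ 0
    · rw [zero_add, tail_zero] at this
      exact this.trans_lt hu'
    · filter_upwards [hb, AEEqFun.coeFn_add u v] with ω h1 h2
      rw [h2]
      exact (norm_add_le _ _).trans (by gcongr)
  · rintro ⟨c, hc, hf⟩
    rw [← sub_add_cancel f (clipClass (AEEqFun.const Ω c) f)]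
    refine add_mem (mem_L1addLinf_of_eLpNorm_one ?_) (mem_L1addLinf_of_eLpNorm_top ?_)
    · rwa [eLpNorm_one_sub_clip hc]
    · exact (eLpNorm_top_clip_le hc f).trans_lt ENNReal.ofReal_lt_top

theorem mem_L1addLinf_of_norm_le {f g : Ω →ₘ[μ] ℂ} (hf : f ∈ L1addLinf μ)
    (h : ∀ᵐ ω ∂μ, ‖g ω‖ ≤ ‖f ω‖) : g ∈ L1addLinf μ := by
  obtain ⟨c, hc, hf⟩ := mem_L1addLinf_iff.1 hf
  refine mem_L1addLinf_iff.2 ⟨c, hc, lt_of_le_of_lt ?_ hf⟩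
  simpa using tail_le_of_norm_le (a := 0) (by simpa using h) c

/-! ### Norm estimates for weighted averages. -/

section DunfordSchwartz

variable {T : Module.End ℂ (L1addLinf μ)}

theorem IsDunfordSchwartz.pow (hT : IsDunfordSchwartz μ T) (k : ℕ) :
    IsDunfordSchwartz μ (T ^ k) := by
  induction k with
  | zero => intro f; simp
  | succ k ih =>
    intro f
    rw [pow_succ', Module.End.mul_apply]
    exact ⟨(hT _).1.trans (ih f).1, (hT _).2.trans (ih f).2⟩

theorem IsDunfordSchwartz.smul (hT : IsDunfordSchwartz μ T) {l : ℂ} (hl : ‖l‖ = 1) :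
    IsDunfordSchwartz μ (l • T) := by
  have key : ∀ (p : ℝ≥0∞) (f : L1addLinf μ),
      eLpNorm ((l • T) f).1 p μ = eLpNorm (T f).1 p μ := by
    intro p f
    rw [LinearMap.smul_apply, Submodule.coe_smul, eLpNorm_congr_ae (AEEqFun.coeFn_smul _ _),
      eLpNorm_const_smul, ← ofReal_norm, hl]
    simp
  intro f
  rw [key, key]
  exact hT f

theorem coeFn_sum {ι : Type*} (s : Finset ι) (f : ι → Ω →ₘ[μ] ℂ) :
    (∑ i ∈ s, f i : Ω →ₘ[μ] ℂ) =ᵐ[μ] fun ω => ∑ i ∈ s, f i ω := by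
  classical
  induction s using Finset.induction_on with
  | empty => simpa using! AEEqFun.coeFn_zero
  | insert a s ha ih =>
    rw [Finset.sum_insert ha]
    filter_upwards [ih, AEEqFun.coeFn_add (f a) (∑ i ∈ s, f i)] with ω h1 h2
    rw [h2, Pi.add_apply, h1, Finset.sum_insert ha]

theorem coeFn_sum_smul {ι : Type*} (s : Finset ι) (b : ι → ℂ) (f : ι → L1addLinf μ) :
    ((∑ i ∈ s, b i • f i : L1addLinf μ) : Ω →ₘ[μ] ℂ) =ᵐ[μ]
      fun ω => ∑ i ∈ s, b i * (f i : Ω →ₘ[μ] ℂ) ω := by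
  classical
  rw [Submodule.coe_sum]
  filter_upwards [coeFn_sum s fun i => ((b i • f i : L1addLinf μ) : Ω →ₘ[μ] ℂ),
    (Finset.eventually_all s).2 fun i _ => AEEqFun.coeFn_smul (b i) (f i : Ω →ₘ[μ] ℂ)] with ω h h'
  rw [h]
  exact Finset.sum_congr rfl fun i hi => h' i hi

theorem coeFn_weightedAvg (β : ℕ → ℂ) (f : L1addLinf μ) (n : ℕ) :
    (weightedAvg μ T β f n : Ω →ₘ[μ] ℂ) =ᵐ[μ]
      fun ω => (1 / (n : ℂ)) * ∑ k ∈ Finset.range n, β k * ((T ^ k) f : L1addLinf μ).1 ω := by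
  unfold weightedAvg
  rw [Submodule.coe_smul]
  filter_upwards [AEEqFun.coeFn_smul (1 / (n : ℂ))
    (∑ k ∈ Finset.range n, β k • (T ^ k) f : L1addLinf μ).1,
    coeFn_sum_smul (Finset.range n) β fun k => (T ^ k) f] with ω h1 h2
  rw [h1, Pi.smul_apply, h2, smul_eq_mul]

theorem eLpNorm_sum_smul_le {ι : Type*} (s : Finset ι) (b : ι → ℂ) (f : ι → L1addLinf μ)
    {p : ℝ≥0∞} (hp : 1 ≤ p) {C : ℝ} (hb : ∀ i, ‖b i‖ ≤ C) :
    eLpNorm (∑ i ∈ s, b i • f i : L1addLinf μ).1 p μ ≤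
      ENNReal.ofReal C * ∑ i ∈ s, eLpNorm (f i).1 p μ := by
  rw [eLpNorm_congr_ae (coeFn_sum_smul s b f)]
  have h1 := eLpNorm_sum_le (μ := μ) (s := s) (f := fun i ω => b i * (f i : Ω →ₘ[μ] ℂ) ω) (p := p)
    (fun i _ => (f i : Ω →ₘ[μ] ℂ).aestronglyMeasurable.const_mul (b i)) hp
  have h2 : (∑ i ∈ s, fun ω => b i * (f i : Ω →ₘ[μ] ℂ) ω) =
      fun ω => ∑ i ∈ s, b i * (f i : Ω →ₘ[μ] ℂ) ω := by
    ext ω; simp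
  rw [h2] at h1
  refine h1.trans ?_
  rw [Finset.mul_sum]
  refine Finset.sum_le_sum fun i _ => ?_
  have h3 : eLpNorm (b i • ((f i : Ω →ₘ[μ] ℂ) : Ω → ℂ)) p μ = _ :=
    eLpNorm_const_smul (b i) (f i : Ω →ₘ[μ] ℂ) p μ
  refine h3.le.trans ?_
  gcongr
  rw [← ofReal_norm]
  exact ENNReal.ofReal_le_ofReal (hb i)

theorem eLpNorm_weightedAvg_le {p : ℝ≥0∞} (hp : 1 ≤ p) {β : ℕ → ℂ} {C : ℝ} (hβ : ∀ k, ‖β k‖ ≤ C)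
    (f : L1addLinf μ) (hT : ∀ k, eLpNorm ((T ^ k) f).1 p μ ≤ eLpNorm f.1 p μ) (n : ℕ) :
    eLpNorm (weightedAvg μ T β f n).1 p μ ≤ ENNReal.ofReal C * eLpNorm f.1 p μ := by
  unfold weightedAvg
  rw [Submodule.coe_smul, eLpNorm_congr_ae (AEEqFun.coeFn_smul _ _), eLpNorm_const_smul]
  rcases Nat.eq_zero_or_pos n with rfl | hn
  · simp
  have h1 := eLpNorm_sum_smul_le (Finset.range n) β (fun k => (T ^ k) f) hp hβ
  have h2 : ∑ k ∈ Finset.range n, eLpNorm ((T ^ k) f).1 p μ ≤ n * eLpNorm f.1 p μ := by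
    refine (Finset.sum_le_sum fun k _ => hT k).trans ?_
    simp
  have h3 : ‖(1 / (n : ℂ))‖ₑ = (n : ℝ≥0∞)⁻¹ := by
    rw [one_div, enorm_inv (by exact_mod_cast hn.ne')]
    congr 1
    rw [← ofReal_norm, Complex.norm_natCast, ENNReal.ofReal_natCast]
  rw [h3]
  calc (n : ℝ≥0∞)⁻¹ * _ ≤ (n : ℝ≥0∞)⁻¹ * (ENNReal.ofReal C * (n * eLpNorm f.1 p μ)) := by
        gcongr
        exact h1.trans (by gcongr)
    _ = ((n : ℝ≥0∞)⁻¹ * n) * (ENNReal.ofReal C * eLpNorm f.1 p μ) := by ring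
    _ = _ := by
      rw [ENNReal.inv_mul_cancel (by exact_mod_cast hn.ne') (ENNReal.natCast_ne_top n), one_mul]

end DunfordSchwartz

end Truncation

/-! ### The filling scheme and maximal inequalities. -/

section Maximal

variable {Ω : Type*} [MeasurableSpace Ω] {μ : Measure Ω}

/-- The part of `h` that fits into the capacity `|c|`. -/
noncomputable def absorb (c : Ω →ₘ[μ] ℝ) (h : L1addLinf μ) : L1addLinf μ :=
  ⟨clipClass |c| h.1, mem_L1addLinf_of_norm_le h.2 <| by
    filter_upwards [coeFn_clipClass |c| h.1, AEEqFun.coeFn_abs c] with ω h1 h2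
    rw [h1, h2, norm_clip (abs_nonneg _)]
    exact min_le_left _ _⟩

theorem norm_absorb (c : Ω →ₘ[μ] ℝ) (h : L1addLinf μ) :
    ∀ᵐ ω ∂μ, ‖(absorb c h).1 ω‖ = min ‖h.1 ω‖ |c ω| ∧
      ‖(h - absorb c h).1 ω‖ = ‖h.1 ω‖ - min ‖h.1 ω‖ |c ω| := by
  filter_upwards [coeFn_clipClass |c| h.1, AEEqFun.coeFn_abs c,
    AEEqFun.coeFn_sub h.1 (absorb c h).1] with ω h1 h2 h3
  have h4 : (absorb c h).1 ω = clip |c ω| (h.1 ω) := by rw [← h2]; exact h1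
  refine ⟨by rw [h4, norm_clip (abs_nonneg _)], ?_⟩
  rw [Submodule.coe_sub, h3, Pi.sub_apply, h4, norm_sub_clip (abs_nonneg _)]

/-- The filling scheme: the incoming function and the remaining capacity at each time. -/
noncomputable def fillState (T : Module.End ℂ (L1addLinf μ)) (f : L1addLinf μ) (lam : ℝ) :
    ℕ → L1addLinf μ × (Ω →ₘ[μ] ℝ)
  | 0 => (f, AEEqFun.const Ω lam)
  | k + 1 =>
    (T ((fillState T f lam k).1 - absorb (fillState T f lam k).2 (fillState T f lam k).1),
      |(fillState T f lam k).2| -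
        AEEqFun.comp norm continuous_norm
          (absorb (fillState T f lam k).2 (fillState T f lam k).1).1)

/-- Chacon's filling scheme: the orbit of `f` is decomposed into absorbed parts `a j`, whose total
size is bounded by `lam`, and remainders `r k`, which vanish where the capacity `lam` has not been
exhausted. -/
theorem IsDunfordSchwartz.exists_filling {T : Module.End ℂ (L1addLinf μ)}
    (hT : IsDunfordSchwartz μ T) (f : L1addLinf μ) {lam : ℝ} (hlam : 0 ≤ lam) :
    ∃ a r : ℕ → L1addLinf μ,
      (∀ k, (T ^ k) f = r k + ∑ i ∈ Finset.range (k + 1), (T ^ i) (a (k - i))) ∧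
      (∀ k, eLpNorm (r k).1 1 μ + ∑ j ∈ Finset.range (k + 1), eLpNorm (a j).1 1 μ ≤
        eLpNorm f.1 1 μ) ∧
      ∀ᵐ ω ∂μ, ∀ k, ∑ j ∈ Finset.range k, ‖(a j).1 ω‖ ≤ lam ∧
        ((r k).1 ω ≠ 0 → ∑ j ∈ Finset.range (k + 1), ‖(a j).1 ω‖ = lam) := by
  set h : ℕ → L1addLinf μ := fun k => (fillState T f lam k).1 with hh
  set c : ℕ → Ω →ₘ[μ] ℝ := fun k => (fillState T f lam k).2 with hc
  set a : ℕ → L1addLinf μ := fun k => absorb (c k) (h k) with ha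
  have hsucc : ∀ k, h (k + 1) = T (h k - a k) := fun k => rfl
  have hnorm : ∀ k, eLpNorm (h k - a k).1 1 μ + eLpNorm (a k).1 1 μ = eLpNorm (h k).1 1 μ := by
    intro k
    simp only [eLpNorm_one_eq_lintegral_enorm]
    rw [← lintegral_add_left (measurable_norm_coe _ |>.ennreal_ofReal |> fun h => by
      simpa only [ofReal_norm] using h)]
    refine lintegral_congr_ae ?_
    filter_upwards [norm_absorb (c k) (h k)] with ω hω
    rw [← ofReal_norm, ← ofReal_norm, ← ofReal_norm, hω.1, hω.2, ← ENNReal.ofReal_add]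
    · simp
    · simp
    · positivity
  refine ⟨a, fun k => h k - a k, ?_, ?_, ?_⟩
  · intro k
    induction k with
    | zero => 
      rw [pow_zero, zero_add, Finset.sum_range_one]
      exact (sub_add_cancel (h 0) (a 0)).symm
    | succ k ih =>
      have e : ∑ i ∈ Finset.range (k + 1 + 1), (T ^ i) (a (k + 1 - i)) =
          T (∑ i ∈ Finset.range (k + 1), (T ^ i) (a (k - i))) + a (k + 1) := by
        rw [Finset.sum_range_succ', map_sum]
        simp only [Nat.add_sub_add_right, pow_zero, Module.End.one_apply, Nat.sub_zero, pow_succ',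
          Module.End.mul_apply]
      rw [e, pow_succ', Module.End.mul_apply, ih, map_add, ← hsucc,
        add_comm (T _) (a (k + 1)), ← add_assoc, sub_add_cancel]
  · intro k
    induction k with
    | zero =>
      rw [zero_add, Finset.sum_range_one, hnorm 0]
      rfl
    | succ k ih =>
      rw [Finset.sum_range_succ, add_comm (∑ j ∈ _, _), ← add_assoc, hnorm (k + 1), hsucc]
      exact (add_le_add_left (hT _).1 _).trans ih
  · have hall : ∀ᵐ ω ∂μ, ∀ k, c (k + 1) ω = |c k ω| - ‖(a k).1 ω‖ := by
      refine ae_all_iff.2 fun k => ?_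
      filter_upwards [AEEqFun.coeFn_sub |c k| (AEEqFun.comp norm continuous_norm (a k).1),
        AEEqFun.coeFn_abs (c k), AEEqFun.coeFn_comp norm continuous_norm (a k).1] with ω h1 h2 h3
      have h4 : c (k + 1) = |c k| - AEEqFun.comp norm continuous_norm (a k).1 := rfl
      rw [h4, h1, Pi.sub_apply, h2, h3]
      rfl
    filter_upwards [hall, AEEqFun.coeFn_const (μ := μ) Ω lam,
      ae_all_iff.2 fun k => norm_absorb (c k) (h k)] with ω h1 h0 h2
    -- The absolute values in the recursion are harmless: what is absorbed never exceeds the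
    -- capacity, so the capacity remains nonnegative.
    have key : ∀ k, 0 ≤ c k ω ∧ c k ω = lam - ∑ j ∈ Finset.range k, ‖(a j).1 ω‖ := by
      intro k
      induction k with
      | zero =>
        have : c 0 ω = lam := h0
        simp [this, hlam]
      | succ k ih =>
        rw [h1 k, Finset.sum_range_succ, abs_of_nonneg ih.1]
        refine ⟨?_, by linarith⟩
        have := (h2 k).1
        rw [abs_of_nonneg ih.1] at this
        have h3 : ‖(a k).1 ω‖ ≤ c k ω := this.le.trans (min_le_right _ _)
        linarith
    intro k
    refine ⟨by linarith [(key k).1, (key k).2], fun hr => ?_⟩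
    have h3 := h2 k
    rw [abs_of_nonneg (key k).1] at h3
    -- A nonzero remainder means that the incoming value exceeded the capacity, which is therefore
    -- used up at this step.
    have h4 : ‖(a k).1 ω‖ = c k ω := by
      refine h3.1.trans (min_eq_right ?_)
      by_contra hlt
      rw [min_eq_left (not_le.1 hlt).le, sub_self, norm_eq_zero] at h3
      exact hr h3.2
    rw [Finset.sum_range_succ, h4]
    linarith [(key k).2]

/-- Weighted maximal inequality for (not necessarily positive) Dunford-Schwartz operators. -/
theorem IsDunfordSchwartz.maximal_one {T : Module.End ℂ (L1addLinf μ)}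
    (hT : IsDunfordSchwartz μ T) {β : ℕ → ℂ} {C : ℝ} (hβ : ∀ k, ‖β k‖ ≤ C) (f : L1addLinf μ)
    {lam : ℝ} (hlam : 0 < lam) :
    μ {ω | ∃ n, C * lam < ‖(weightedAvg μ T β f n).1 ω‖} ≤
      (ENNReal.ofReal lam)⁻¹ * eLpNorm f.1 1 μ := by
  have hC : 0 ≤ C := (norm_nonneg _).trans (hβ 0)
  obtain ⟨a, r, h1, h2, h3⟩ := hT.exists_filling f hlam.le
  -- the average of `f` is the average of the remainders plus a part bounded by `C * lam`
  have hid : ∀ n, ∑ k ∈ Finset.range n, β k • (T ^ k) f =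
      ∑ k ∈ Finset.range n, β k • r k +
        ∑ i ∈ Finset.range n, (T ^ i) (∑ j ∈ Finset.range (n - i), β (i + j) • a j) := by
    intro n
    have e1 : ∀ k, β k • (T ^ k) f = β k • r k +
        ∑ i ∈ Finset.range (k + 1), β (i + (k - i)) • (T ^ i) (a (k - i)) := by
      intro k
      rw [h1 k, smul_add, Finset.smul_sum]
      congr 1
      refine Finset.sum_congr rfl fun i hi => ?_
      rw [Nat.add_sub_cancel' (Nat.lt_succ_iff.1 (Finset.mem_range.1 hi))]
    rw [Finset.sum_congr rfl fun k _ => e1 k, Finset.sum_add_distrib,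
      Finset.sum_range_diag_flip n fun i j => β (i + j) • (T ^ i) (a j)]
    simp only [map_sum, map_smul]
  -- Grouping by the power `i` puts the whole sum over `j` under one `T ^ i`. That sum is bounded by
  -- `C * lam` because the absorbed parts add up to at most `lam`, and `T ^ i` contracts `L^∞`.
  have hbd : ∀ n i, ∀ᵐ ω ∂μ,
      ‖((T ^ i) (∑ j ∈ Finset.range (n - i), β (i + j) • a j)).1 ω‖ ≤ C * lam := by
    intro n i
    rw [← eLpNorm_top_le_iff (by positivity)]
    refine ((hT.pow i) _).2.trans ?_
    rw [eLpNorm_top_le_iff (by positivity)]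
    filter_upwards [h3, coeFn_sum_smul (Finset.range (n - i)) (fun j => β (i + j)) a] with ω h h'
    rw [h']
    refine (norm_sum_le _ _).trans ?_
    calc ∑ j ∈ Finset.range (n - i), ‖β (i + j) * (a j).1 ω‖
        ≤ ∑ j ∈ Finset.range (n - i), C * ‖(a j).1 ω‖ := by
          refine Finset.sum_le_sum fun j _ => ?_
          rw [norm_mul]
          gcongr
          exact hβ _
      _ ≤ C * lam := by
          rw [← Finset.mul_sum]
          exact mul_le_mul_of_nonneg_left (h _).1 hC
  -- If all remainders vanished at `ω`, every average there would be at most `C * lam`. So some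
  -- remainder is nonzero, and the capacity `lam` is exhausted at `ω`.
  have hsub : ∀ᵐ ω ∂μ, (∃ n, C * lam < ‖(weightedAvg μ T β f n).1 ω‖) →
      ENNReal.ofReal lam ≤ ∑' j, ‖(a j).1 ω‖ₑ := by
    have hall : ∀ᵐ ω ∂μ, ∀ n, (∑ k ∈ Finset.range n, β k • (T ^ k) f : L1addLinf μ).1 ω =
        ∑ k ∈ Finset.range n, β k * (r k).1 ω + ∑ i ∈ Finset.range n,
          ((T ^ i) (∑ j ∈ Finset.range (n - i), β (i + j) • a j)).1 ω := by
      refine ae_all_iff.2 fun n => ?_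
      rw [hid n, Submodule.coe_add]
      filter_upwards [AEEqFun.coeFn_add (∑ k ∈ Finset.range n, β k • r k : L1addLinf μ).1
        (∑ i ∈ Finset.range n, (T ^ i) (∑ j ∈ Finset.range (n - i), β (i + j) • a j) :
          L1addLinf μ).1, coeFn_sum_smul (Finset.range n) β r,
        coeFn_sum (Finset.range n) fun i =>
          ((T ^ i) (∑ j ∈ Finset.range (n - i), β (i + j) • a j)).1] with ω e1 e2 e3
      rw [e1, Pi.add_apply, e2, Submodule.coe_sum, e3]
    have hall' : ∀ᵐ ω ∂μ, ∀ n, (weightedAvg μ T β f n).1 ω =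
        (1 / (n : ℂ)) * (∑ k ∈ Finset.range n, β k • (T ^ k) f : L1addLinf μ).1 ω :=
      ae_all_iff.2 fun n => AEEqFun.coeFn_smul _ _
    filter_upwards [h3, hall, hall', ae_all_iff.2 fun n => ae_all_iff.2 fun i => hbd n i]
      with ω e1 e2 e3 e4 ⟨n, hn⟩
    have hex : ∃ k, (r k).1 ω ≠ 0 := by
      by_contra! hno
      refine absurd hn (not_lt.2 ?_)
      rw [e3 n, e2 n, Finset.sum_eq_zero (fun k _ => by rw [hno k, mul_zero]), zero_add, norm_mul]
      have : ‖∑ i ∈ Finset.range n,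
          ((T ^ i) (∑ j ∈ Finset.range (n - i), β (i + j) • a j)).1 ω‖ ≤ n * (C * lam) := by
        refine (norm_sum_le _ _).trans ((Finset.sum_le_sum fun i _ => e4 n i).trans ?_)
        simp
      rcases Nat.eq_zero_or_pos n with rfl | hnpos
      · simp; positivity
      have hn' : (0 : ℝ) < n := by exact_mod_cast hnpos
      calc ‖(1 / (n : ℂ))‖ * _ ≤ ‖(1 / (n : ℂ))‖ * (n * (C * lam)) := by gcongr
        _ = C * lam := by
          rw [norm_div, norm_one, Complex.norm_natCast]
          field_simp
    obtain ⟨k, hk⟩ := hex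
    rw [← (e1 k).2 hk, ENNReal.ofReal_sum_of_nonneg fun _ _ => norm_nonneg _]
    simp only [ofReal_norm]
    exact ENNReal.sum_le_tsum _
  have hmeas : ∀ j, Measurable fun ω => ‖(a j).1 ω‖ₑ := fun j => by
    simpa only [ofReal_norm] using (measurable_norm_coe (a j).1).ennreal_ofReal
  -- Markov's inequality for the total absorbed size, whose integral is at most `‖f‖₁`.
  have hmarkov : ENNReal.ofReal lam * μ {ω | ENNReal.ofReal lam ≤ ∑' j, ‖(a j).1 ω‖ₑ} ≤
      eLpNorm f.1 1 μ := by
    refine (mul_meas_ge_le_lintegral (Measurable.tsum hmeas) _).trans ?_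
    rw [lintegral_tsum fun j => (hmeas j).aemeasurable]
    refine ENNReal.tsum_le_of_sum_range_le fun n => ?_
    rcases n with _ | n
    · simp
    · simp only [eLpNorm_one_eq_lintegral_enorm] at h2
      simpa only [eLpNorm_one_eq_lintegral_enorm] using le_add_self.trans (h2 n)
  calc μ {ω | ∃ n, C * lam < ‖(weightedAvg μ T β f n).1 ω‖}
      ≤ μ {ω | ENNReal.ofReal lam ≤ ∑' j, ‖(a j).1 ω‖ₑ} := measure_mono_ae hsub
    _ = (ENNReal.ofReal lam)⁻¹ *
        (ENNReal.ofReal lam * μ {ω | ENNReal.ofReal lam ≤ ∑' j, ‖(a j).1 ω‖ₑ}) := by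
      rw [← mul_assoc, ENNReal.inv_mul_cancel (by simpa using hlam) ENNReal.ofReal_ne_top, one_mul]
    _ ≤ _ := by gcongr

theorem weightedAvg_add (T : Module.End ℂ (L1addLinf μ)) (β : ℕ → ℂ) (f g : L1addLinf μ) (n : ℕ) :
    weightedAvg μ T β (f + g) n = weightedAvg μ T β f n + weightedAvg μ T β g n := by
  simp [weightedAvg, smul_add, Finset.sum_add_distrib]

/-- The truncation at a constant height as an element of `L¹ + L^∞`. -/
theorem exists_clip_decomp (f : L1addLinf μ) {c : ℝ} (hc : 0 ≤ c) :
    ∃ u v : L1addLinf μ, f = u + v ∧ eLpNorm u.1 1 μ = tail μ f.1 c ∧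
      eLpNorm v.1 ∞ μ ≤ ENNReal.ofReal c := by
  have hv := eLpNorm_top_clip_le (μ := μ) hc f.1
  have hu := eLpNorm_one_sub_clip (μ := μ) hc f.1
  generalize clipClass (AEEqFun.const Ω c) f.1 = v at hu hv
  have hv' : v ∈ L1addLinf μ := mem_L1addLinf_of_eLpNorm_top (hv.trans_lt ENNReal.ofReal_lt_top)
  refine ⟨f - ⟨v, hv'⟩, ⟨v, hv'⟩, (sub_add_cancel _ _).symm, ?_, hv⟩
  rw [← hu, Submodule.coe_sub]

/-- Truncate `f` at height `lam`: the averages of the bounded part stay below `C * lam`, so those of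
the integrable part, of norm `tail μ f lam`, must exceed the other `C * lam`. -/
theorem IsDunfordSchwartz.maximal {T : Module.End ℂ (L1addLinf μ)}
    (hT : IsDunfordSchwartz μ T) {β : ℕ → ℂ} {C : ℝ} (hβ : ∀ k, ‖β k‖ ≤ C) (f : L1addLinf μ)
    {lam : ℝ} (hlam : 0 < lam) :
    μ {ω | ∃ n, 2 * C * lam < ‖(weightedAvg μ T β f n).1 ω‖} ≤
      (ENNReal.ofReal lam)⁻¹ * tail μ f.1 lam := by
  have hC : 0 ≤ C := (norm_nonneg _).trans (hβ 0)
  obtain ⟨u, v, rfl, hu, hv⟩ := exists_clip_decomp f hlam.le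
  rw [← hu]
  refine le_trans (measure_mono_ae ?_) (hT.maximal_one hβ u hlam)
  have h1 : ∀ᵐ ω ∂μ, ∀ n, ‖(weightedAvg μ T β v n).1 ω‖ ≤ C * lam := by
    refine ae_all_iff.2 fun n => (eLpNorm_top_le_iff (by positivity)).1 ?_
    refine (eLpNorm_weightedAvg_le le_top hβ v (fun k => (hT.pow k v).2) n).trans ?_
    rw [ENNReal.ofReal_mul hC]
    gcongr
  have h2 : ∀ᵐ ω ∂μ, ∀ n, (weightedAvg μ T β (u + v) n).1 ω =
      (weightedAvg μ T β u n).1 ω + (weightedAvg μ T β v n).1 ω := by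
    refine ae_all_iff.2 fun n => ?_
    rw [weightedAvg_add]
    exact AEEqFun.coeFn_add _ _
  filter_upwards [h1, h2] with ω h1 h2 ⟨n, hn⟩
  refine ⟨n, ?_⟩
  rw [h2 n] at hn
  linarith [norm_add_le ((weightedAvg μ T β u n).1 ω) ((weightedAvg μ T β v n).1 ω), h1 n]

/-- An additive map that is bounded by `C` in `L¹` and in `L^∞` is bounded by `C` in the sense of
tails. -/
theorem tail_map_le {S : L1addLinf μ → L1addLinf μ} (hadd : ∀ u v, S (u + v) = S u + S v) {C : ℝ}
    (hC : 0 ≤ C) (h1 : ∀ u, eLpNorm (S u).1 1 μ ≤ ENNReal.ofReal C * eLpNorm u.1 1 μ)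
    (hinf : ∀ u, eLpNorm (S u).1 ∞ μ ≤ ENNReal.ofReal C * eLpNorm u.1 ∞ μ) (f : L1addLinf μ)
    {c : ℝ} (hc : 0 ≤ c) : tail μ (S f).1 (C * c) ≤ ENNReal.ofReal C * tail μ f.1 c := by
  obtain ⟨u, v, rfl, hu, hv⟩ := exists_clip_decomp f hc
  rw [← hu]
  have hb : ∀ᵐ ω ∂μ, ‖(S v).1 ω‖ ≤ C * c := by
    refine (eLpNorm_top_le_iff (by positivity)).1 ((hinf v).trans ?_)
    rw [ENNReal.ofReal_mul hC]
    gcongr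
  refine le_trans ?_ (h1 u)
  rw [← tail_zero, ← zero_add (C * c)]
  refine tail_le_of_norm_le ?_ 0
  rw [hadd]
  filter_upwards [hb, AEEqFun.coeFn_add (S u).1 (S v).1] with ω h1 h2
  rw [Submodule.coe_add, h2, Pi.add_apply]
  exact (norm_add_le _ _).trans (by gcongr)

theorem IsDunfordSchwartz.tail_le {T : Module.End ℂ (L1addLinf μ)} (hT : IsDunfordSchwartz μ T)
    (f : L1addLinf μ) {c : ℝ} (hc : 0 ≤ c) : tail μ (T f).1 c ≤ tail μ f.1 c := by
  simpa using tail_map_le (S := T) (map_add T) zero_le_one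
    (by simpa using fun u hu => (hT ⟨u, hu⟩).1) (by simpa using fun u hu => (hT ⟨u, hu⟩).2) f hc

/-- Averages of a Dunford-Schwartz operator are dominated in the sense of tails. -/
theorem IsDunfordSchwartz.tail_weightedAvg_le {T : Module.End ℂ (L1addLinf μ)}
    (hT : IsDunfordSchwartz μ T) {β : ℕ → ℂ} {C : ℝ} (hβ : ∀ k, ‖β k‖ ≤ C) (f : L1addLinf μ)
    {c : ℝ} (hc : 0 ≤ c) (n : ℕ) :
    tail μ (weightedAvg μ T β f n).1 (C * c) ≤ ENNReal.ofReal C * tail μ f.1 c :=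
  tail_map_le (S := fun u => weightedAvg μ T β u n) (fun u v => weightedAvg_add T β u v n)
    ((norm_nonneg _).trans (hβ 0))
    (fun u => eLpNorm_weightedAvg_le le_rfl hβ u (fun k => (hT.pow k u).1) n)
    (fun u => eLpNorm_weightedAvg_le le_top hβ u (fun k => (hT.pow k u).2) n) f hc

end Maximal

/-! ### Distribution functions and Hardy's lemma. -/

section Distribution

/-- The source of both the layer cake formulas with values in `[0, ∞]` and the equimeasurability of
`f` and `f*`. -/
theorem volume_setOf_ofReal_lt (a : ℝ≥0∞) :
    (volume.restrict (Ioi 0)) {y : ℝ | ENNReal.ofReal y < a} = a := by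
  rcases eq_or_ne a ∞ with rfl | ha
  · simp
  lift a to NNReal using ha
  rw [Measure.restrict_apply' measurableSet_Ioi]
  have : {y : ℝ | ENNReal.ofReal y < a} ∩ Ioi 0 = Ioo 0 (a : ℝ) := by
    ext y
    simp only [mem_inter_iff, mem_ofPred_eq, mem_Ioi, mem_Ioo]
    constructor
    · rintro ⟨h1, h2⟩
      refine ⟨h2, ?_⟩
      rwa [← ENNReal.ofReal_coe_nnreal, ENNReal.ofReal_lt_ofReal_iff_of_nonneg h2.le] at h1
    · rintro ⟨h1, h2⟩
      rw [← ENNReal.ofReal_coe_nnreal, ENNReal.ofReal_lt_ofReal_iff_of_nonneg h1.le]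
      exact ⟨h2, h1⟩
  rw [this, Real.volume_Ioo, sub_zero, ENNReal.ofReal_coe_nnreal]

/-- Hardy's lemma: domination of the integrals over all rays `(c, ∞)` gives domination of the
integrals against all increasing weights. -/
theorem lintegral_mul_le_of_forall_Ioi {A B w : ℝ → ℝ≥0∞} (hA : Measurable A) (hB : Measurable B)
    (hw : MonotoneOn w (Ioi 0))
    (h : ∀ c : ℝ, 0 ≤ c → ∫⁻ t in Ioi c, A t ≤ ∫⁻ t in Ioi c, B t) :
    ∫⁻ t in Ioi 0, A t * w t ≤ ∫⁻ t in Ioi 0, B t * w t := by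
  have hmono : Monotone ((Ioi (0 : ℝ)).indicator w) := by
    intro s t hst
    by_cases hs : 0 < s
    · rw [indicator_of_mem (mem_Ioi.2 hs), indicator_of_mem (mem_Ioi.2 (hs.trans_le hst))]
      exact hw hs (hs.trans_le hst) hst
    · rw [indicator_of_notMem (by simpa using hs)]
      exact bot_le
  set v := (Ioi (0 : ℝ)).indicator w with hv
  have hvm := hmono.measurable
  -- Layer cake in the weight: the weighted integral becomes an average of integrals over superlevel
  -- sets of `v`.
  have key : ∀ D : ℝ → ℝ≥0∞, Measurable D → ∫⁻ t in Ioi 0, D t * w t =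
      ∫⁻ y in Ioi (0 : ℝ), ∫⁻ t in {t | ENNReal.ofReal y < v t}, D t := by
    intro D hD
    have hm : MeasurableSet {p : ℝ × ℝ | ENNReal.ofReal p.2 < v p.1} :=
      measurableSet_lt (by fun_prop) (by fun_prop)
    calc ∫⁻ t in Ioi 0, D t * w t = ∫⁻ t, D t * v t := by
          rw [← lintegral_indicator measurableSet_Ioi]
          refine lintegral_congr fun t => ?_
          by_cases ht : t ∈ Ioi (0 : ℝ) <;> simp [hv, ht]
      _ = ∫⁻ t, ∫⁻ y in Ioi (0 : ℝ),
          {p : ℝ × ℝ | ENNReal.ofReal p.2 < v p.1}.indicator (fun p => D p.1) (t, y) := by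
          refine lintegral_congr fun t => ?_
          have : (fun y => {p : ℝ × ℝ | ENNReal.ofReal p.2 < v p.1}.indicator
              (fun p => D p.1) (t, y)) = {y : ℝ | ENNReal.ofReal y < v t}.indicator
              fun _ => D t := rfl
          rw [this, lintegral_indicator_const (measurableSet_lt (by fun_prop) measurable_const),
            volume_setOf_ofReal_lt]
      _ = ∫⁻ y in Ioi (0 : ℝ), ∫⁻ t,
          {p : ℝ × ℝ | ENNReal.ofReal p.2 < v p.1}.indicator (fun p => D p.1) (t, y) :=
          lintegral_lintegral_swap ((hD.comp measurable_fst).indicator hm).aemeasurable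
      _ = _ := by
          refine lintegral_congr fun y => ?_
          rw [← lintegral_indicator (measurableSet_lt measurable_const hvm)]
          rfl
  rw [key A hA, key B hB]
  refine lintegral_mono fun y => ?_
  rcases eq_empty_or_nonempty {t | ENNReal.ofReal y < v t} with he | hne
  · simp [he]
  have hpos : ∀ t ∈ {t | ENNReal.ofReal y < v t}, 0 < t := by
    intro t ht
    by_contra hcon
    have : v t = 0 := indicator_of_notMem (by simpa using hcon) _
    simp [this] at ht
  have hbdd : BddBelow {t | ENNReal.ofReal y < v t} := ⟨0, fun t ht => (hpos t ht).le⟩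
  -- Since `v` is increasing, a superlevel set is a ray, up to its endpoint, which is null.
  have hae : {t | ENNReal.ofReal y < v t} =ᵐ[volume] Ioi (sInf {t | ENNReal.ofReal y < v t}) := by
    refine Filter.EventuallyLE.antisymm ?_ (LE.le.eventuallyLE ?_)
    · exact (LE.le.eventuallyLE fun t ht => mem_Ici.2 (csInf_le hbdd ht)).trans
        Ioi_ae_eq_Ici.symm.le
    · intro t ht
      obtain ⟨s, hs, hst⟩ := exists_lt_of_csInf_lt hne ht
      exact lt_of_lt_of_le hs (hmono hst.le)
  rw [setLIntegral_congr hae, setLIntegral_congr hae]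
  exact h _ (le_csInf hne fun t ht => (hpos t ht).le)

variable {Ω : Type*} [MeasurableSpace Ω] {μ : Measure Ω}

theorem measurable_distribution (f : Ω →ₘ[μ] ℂ) : Measurable fun t : ℝ => μ {ω | t < ‖f ω‖} :=
  Antitone.measurable fun _ _ hst => measure_mono fun _ h => lt_of_le_of_lt hst h

/-- The layer cake formula for `(|f| - c)⁺`, shifted by `c`. In this form tail domination is exactly
the hypothesis of Hardy's lemma. -/
theorem tail_eq_lintegral_distribution (f : Ω →ₘ[μ] ℂ) (c : ℝ) :
    tail μ f c = ∫⁻ t in Ioi c, μ {ω | t < ‖f ω‖} := by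
  have h1 : tail μ f c = ∫⁻ ω, ENNReal.ofReal (max (‖f ω‖ - c) 0) ∂μ := by
    refine lintegral_congr fun ω => ?_
    rw [ENNReal.ofReal_max, ENNReal.ofReal_zero, max_eq_left zero_le]
  rw [h1, lintegral_eq_lintegral_meas_lt (f := fun ω => max (‖f ω‖ - c) 0) μ (ae_of_all _ fun _ => le_max_right _ _)
    (((measurable_norm_coe f).sub_const c).max measurable_const).aemeasurable]
  have h2 := (measurePreserving_add_right (volume : Measure ℝ) c).setLIntegral_comp_preimage
    (measurableSet_Ioi (a := c)) (measurable_distribution f)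
  rw [← h2]
  have h3 : (fun t : ℝ => t + c) ⁻¹' Ioi c = Ioi 0 := by ext; simp
  rw [h3]
  refine setLIntegral_congr_fun measurableSet_Ioi fun t ht => ?_
  congr 1
  ext ω
  have ht' : 0 < t := ht
  simp only [mem_ofPred_eq, lt_max_iff, not_lt_of_gt ht', or_false]
  constructor <;> intro <;> linarith

/-- Tail domination implies domination of integrals of convex functions. -/
theorem lintegral_primitive_le {f g : Ω →ₘ[μ] ℂ} (h : ∀ c, 0 ≤ c → tail μ g c ≤ tail μ f c)
    {w : ℝ → ℝ} (hw : MonotoneOn w (Ioi 0)) (hw0 : ∀ t, 0 < t → 0 ≤ w t)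
    (hint : ∀ t > 0, IntervalIntegrable w volume 0 t) :
    ∫⁻ ω, ENNReal.ofReal (∫ t in 0..‖g ω‖, w t) ∂μ ≤
      ∫⁻ ω, ENNReal.ofReal (∫ t in 0..‖f ω‖, w t) ∂μ := by
  have hw0' : ∀ᵐ t ∂volume.restrict (Ioi (0 : ℝ)), 0 ≤ w t :=
    (ae_restrict_mem measurableSet_Ioi).mono hw0
  rw [lintegral_comp_eq_lintegral_meas_lt_mul μ (ae_of_all _ fun _ => norm_nonneg _)
    (measurable_norm_coe g).aemeasurable hint hw0',
    lintegral_comp_eq_lintegral_meas_lt_mul μ (ae_of_all _ fun _ => norm_nonneg _)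
    (measurable_norm_coe f).aemeasurable hint hw0']
  refine lintegral_mul_le_of_forall_Ioi (measurable_distribution g) (measurable_distribution f)
    (fun s hs t ht hst => ENNReal.ofReal_le_ofReal (hw hs ht hst)) fun c hc => ?_
  rw [← tail_eq_lintegral_distribution g c, ← tail_eq_lintegral_distribution f c]
  exact h c hc

/-- The case `u² = ∫₀ᵘ 2t dt` of `lintegral_primitive_le`; it replaces an interpolation theorem
between `L¹` and `L^∞`. -/
theorem eLpNorm_two_le {f g : Ω →ₘ[μ] ℂ} (h : ∀ c, 0 ≤ c → tail μ g c ≤ tail μ f c) :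
    eLpNorm g 2 μ ≤ eLpNorm f 2 μ := by
  have key : ∀ u : Ω →ₘ[μ] ℂ, ∫⁻ ω, ‖u ω‖ₑ ^ (2 : ℝ) ∂μ =
      ∫⁻ ω, ENNReal.ofReal (∫ t in 0..‖u ω‖, 2 * t) ∂μ := by
    intro u
    refine lintegral_congr fun ω => ?_
    rw [intervalIntegral.integral_const_mul, integral_id, ← ofReal_norm,
      ENNReal.ofReal_rpow_of_nonneg (norm_nonneg _) (by norm_num)]
    congr 1
    norm_num
    ring
  rw [eLpNorm_eq_lintegral_rpow_enorm_toReal (by norm_num) (by norm_num),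
    eLpNorm_eq_lintegral_rpow_enorm_toReal (by norm_num) (by norm_num)]
  simp only [ENNReal.toReal_ofNat, key]
  gcongr ?_ ^ _
  exact lintegral_primitive_le h (fun s _ t _ hst => by simpa using hst)
    (fun t ht => by positivity) fun t _ => (continuous_const.mul continuous_id).intervalIntegrable _ _

end Distribution

/-! ### Almost uniform Cauchy sequences. -/

section AlmostUniform

variable {Ω : Type*} [MeasurableSpace Ω] {μ : Measure Ω}

/-- Sequences that are Cauchy almost uniformly. -/
def CauchyAU (μ : Measure Ω) (u : ℕ → (Ω →ₘ[μ] ℂ)) : Prop :=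
  ∀ ε : ℝ, 0 < ε → ∃ N : ℕ,
    μ {ω | ∃ m ≥ N, ∃ n ≥ N, ε < ‖u m ω - u n ω‖} ≤ ENNReal.ofReal ε

/-- An almost uniform approximation principle. -/
theorem CauchyAU.of_approx {u : ℕ → (Ω →ₘ[μ] ℂ)}
    (h : ∀ ε : ℝ, 0 < ε → ∃ v, CauchyAU μ v ∧ ∃ N : ℕ,
      μ {ω | ∃ n ≥ N, ε < ‖u n ω - v n ω‖} ≤ ENNReal.ofReal ε) : CauchyAU μ u := by
  intro ε hε
  obtain ⟨v, hv, N₁, h₁⟩ := h (ε / 3) (by positivity)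
  obtain ⟨N₂, h₂⟩ := hv (ε / 3) (by positivity)
  refine ⟨max N₁ N₂, ?_⟩
  calc μ {ω | ∃ m ≥ max N₁ N₂, ∃ n ≥ max N₁ N₂, ε < ‖u m ω - u n ω‖}
      ≤ μ ({ω | ∃ n ≥ N₁, ε / 3 < ‖u n ω - v n ω‖} ∪
          {ω | ∃ m ≥ N₂, ∃ n ≥ N₂, ε / 3 < ‖v m ω - v n ω‖}) := by
        refine measure_mono ?_
        rintro ω ⟨m, hm, n, hn, hlt⟩
        by_contra hcon
        simp only [mem_union, mem_ofPred_eq, not_or, not_exists, not_and, not_lt] at hcon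
        have e1 := hcon.1 m (le_of_max_le_left hm)
        have e2 := hcon.1 n (le_of_max_le_left hn)
        have e3 := hcon.2 m (le_of_max_le_right hm) n (le_of_max_le_right hn)
        have e4 : u m ω - u n ω = (u m ω - v m ω) + (v m ω - v n ω) - (u n ω - v n ω) := by ring
        rw [e4] at hlt
        linarith [norm_sub_le ((u m ω - v m ω) + (v m ω - v n ω)) (u n ω - v n ω),
          norm_add_le (u m ω - v m ω) (v m ω - v n ω)]
    _ ≤ ENNReal.ofReal (ε / 3) + ENNReal.ofReal (ε / 3) :=
        (measure_union_le _ _).trans (add_le_add h₁ h₂)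
    _ ≤ ENNReal.ofReal ε := by
        rw [← ENNReal.ofReal_add (by positivity) (by positivity)]
        exact ENNReal.ofReal_le_ofReal (by linarith)

theorem CauchyAU.of_ae_le {u : ℕ → (Ω →ₘ[μ] ℂ)} {f : Ω →ₘ[μ] ℂ} {b : ℕ → ℝ}
    (hb : Tendsto b atTop (𝓝 0)) (h : ∀ᵐ ω ∂μ, ∀ n, 0 < n → ‖u n ω - f ω‖ ≤ b n) :
    CauchyAU μ u := by
  intro ε hε
  obtain ⟨N, hN⟩ := eventually_atTop.1 (hb.eventually (gt_mem_nhds (half_pos hε)))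
  refine ⟨N + 1, le_of_eq_of_le ?_ bot_le⟩
  refine measure_mono_null (t := {ω | ¬ ∀ n, 0 < n → ‖u n ω - f ω‖ ≤ b n}) ?_ h
  rintro ω ⟨m, hm, n, hn, hlt⟩ hcon
  have e4 : u m ω - u n ω = (u m ω - f ω) - (u n ω - f ω) := by ring
  rw [e4] at hlt
  linarith [norm_sub_le (u m ω - f ω) (u n ω - f ω), hcon m (by omega), hcon n (by omega),
    hN m (by omega), hN n (by omega)]

theorem CauchyAU.add {u v : ℕ → (Ω →ₘ[μ] ℂ)} (hu : CauchyAU μ u) (hv : CauchyAU μ v) :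
    CauchyAU μ fun n => u n + v n := by
  intro ε hε
  obtain ⟨N₁, h₁⟩ := hu (ε / 2) (by positivity)
  obtain ⟨N₂, h₂⟩ := hv (ε / 2) (by positivity)
  refine ⟨max N₁ N₂, ?_⟩
  calc μ {ω | ∃ m ≥ max N₁ N₂, ∃ n ≥ max N₁ N₂, ε < ‖(u m + v m) ω - (u n + v n) ω‖}
      ≤ μ ({ω | ∃ m ≥ N₁, ∃ n ≥ N₁, ε / 2 < ‖u m ω - u n ω‖} ∪
          {ω | ∃ m ≥ N₂, ∃ n ≥ N₂, ε / 2 < ‖v m ω - v n ω‖}) := by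
        refine measure_mono_ae ?_
        filter_upwards [ae_all_iff.2 fun n => AEEqFun.coeFn_add (u n) (v n)]
          with ω hω ⟨m, hm, n, hn, hlt⟩
        by_contra hcon
        obtain ⟨hc1, hc2⟩ := not_or.1 hcon
        have e1 : ‖u m ω - u n ω‖ ≤ ε / 2 := not_lt.1 fun hh =>
          hc1 ⟨m, le_of_max_le_left hm, n, le_of_max_le_left hn, hh⟩
        have e2 : ‖v m ω - v n ω‖ ≤ ε / 2 := not_lt.1 fun hh =>
          hc2 ⟨m, le_of_max_le_right hm, n, le_of_max_le_right hn, hh⟩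
        have e4 : (u m + v m) ω - (u n + v n) ω = (u m ω - u n ω) + (v m ω - v n ω) := by
          rw [hω m, hω n, Pi.add_apply, Pi.add_apply]; ring
        rw [e4] at hlt
        linarith [norm_add_le (u m ω - u n ω) (v m ω - v n ω)]
    _ ≤ ENNReal.ofReal (ε / 2) + ENNReal.ofReal (ε / 2) :=
        (measure_union_le _ _).trans (add_le_add h₁ h₂)
    _ = ENNReal.ofReal ε := by
        rw [← ENNReal.ofReal_add (by positivity) (by positivity), add_halves]

theorem CauchyAU.const_smul {u : ℕ → (Ω →ₘ[μ] ℂ)} (hu : CauchyAU μ u) (z : ℂ) :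
    CauchyAU μ fun n => z • u n := by
  intro ε hε
  have hz : 0 < ‖z‖ + 1 := by positivity
  obtain ⟨N, hN⟩ := hu (ε / (‖z‖ + 1)) (by positivity)
  refine ⟨N, (measure_mono_ae ?_).trans (hN.trans (ENNReal.ofReal_le_ofReal
    (div_le_self hε.le (by linarith [norm_nonneg z]))))⟩
  filter_upwards [ae_all_iff.2 fun n => AEEqFun.coeFn_smul z (u n)] with ω hω ⟨m, hm, n, hn, hlt⟩
  refine ⟨m, hm, n, hn, ?_⟩
  rw [hω m, hω n, Pi.smul_apply, Pi.smul_apply, ← smul_sub, norm_smul] at hlt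
  rw [div_lt_iff₀ hz]
  nlinarith [norm_nonneg (u m ω - u n ω)]

theorem CauchyAU.zero : CauchyAU μ fun _ => (0 : Ω →ₘ[μ] ℂ) :=
  CauchyAU.of_ae_le (f := 0) (b := fun _ => 0) tendsto_const_nhds (ae_of_all _ fun _ _ _ => by simp)

theorem CauchyAU.sum {ι : Type*} (s : Finset ι) {u : ι → ℕ → (Ω →ₘ[μ] ℂ)}
    (h : ∀ i ∈ s, CauchyAU μ (u i)) : CauchyAU μ fun n => ∑ i ∈ s, u i n := by
  classical
  induction s using Finset.induction_on with
  | empty => simpa using CauchyAU.zero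
  | insert a s ha ih =>
    simp only [Finset.sum_insert ha]
    exact (h a (Finset.mem_insert_self _ _)).add
      (ih fun i hi => h i (Finset.mem_insert_of_mem hi))

/-- An almost uniformly Cauchy sequence converges almost uniformly. -/
theorem CauchyAU.exists_tendstoAU {u : ℕ → (Ω →ₘ[μ] ℂ)} (hu : CauchyAU μ u) :
    ∃ g : Ω →ₘ[μ] ℂ, TendstoAU μ u g ∧ ∀ᵐ ω ∂μ, Tendsto (fun n => u n ω) atTop (𝓝 (g ω)) := by
  have good : ∀ ε : ℝ, 0 < ε → ∃ G : Set Ω, MeasurableSet G ∧ μ Gᶜ ≤ ENNReal.ofReal ε ∧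
      ∀ δ : ℝ, 0 < δ → ∃ N, ∀ m ≥ N, ∀ n ≥ N, ∀ ω ∈ G, ‖u m ω - u n ω‖ ≤ δ := by
    intro ε hε
    -- Errors `ε / 2 ^ (j + 1)` sum to `ε`, so the union of all exceptional sets is small and off it
    -- the Cauchy condition holds at every scale.
    choose N hN using fun j : ℕ => hu (ε / 2 / 2 ^ j) (by positivity)
    set B : ℕ → Set Ω := fun j =>
      {ω | ∃ m ≥ N j, ∃ n ≥ N j, ε / 2 / 2 ^ j < ‖u m ω - u n ω‖} with hB
    have hBm : ∀ j, MeasurableSet (B j) := by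
      intro j
      have : B j = ⋃ m ≥ N j, ⋃ n ≥ N j, {ω | ε / 2 / 2 ^ j < ‖u m ω - u n ω‖} := by
        ext ω; simp [hB]
      rw [this]
      refine MeasurableSet.iUnion fun m => MeasurableSet.iUnion fun _ => MeasurableSet.iUnion
        fun n => MeasurableSet.iUnion fun _ => measurableSet_lt measurable_const ?_
      exact ((u m).stronglyMeasurable.measurable.sub (u n).stronglyMeasurable.measurable).norm
    refine ⟨(⋃ j, B j)ᶜ, (MeasurableSet.iUnion hBm).compl, ?_, ?_⟩
    · rw [compl_compl]
      refine (measure_iUnion_le _).trans ((ENNReal.tsum_le_tsum hN).trans ?_)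
      rw [← ENNReal.ofReal_tsum_of_nonneg (fun j => by positivity) (summable_geometric_two' ε),
        tsum_geometric_two']
    · intro δ hδ
      have hlim : Tendsto (fun j : ℕ => ε / 2 / 2 ^ j) atTop (𝓝 0) :=
        (summable_geometric_two' ε).tendsto_atTop_zero
      obtain ⟨j, hj⟩ := (hlim.eventually (gt_mem_nhds hδ)).exists
      refine ⟨N j, fun m hm n hn ω hω => ?_⟩
      by_contra hcon
      exact hω (mem_iUnion.2 ⟨j, m, hm, n, hn, hj.trans (not_le.1 hcon)⟩)
  have hcau : ∀ᵐ ω ∂μ, ∃ l, Tendsto (fun n => u n ω) atTop (𝓝 l) := by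
    -- The set of divergence lies in every exceptional set, so its measure is below every `r > 0`.
    refine nonpos_iff_eq_zero.1 (le_of_forall_gt_imp_ge_of_dense fun r hr => ?_)
    rcases eq_or_ne r ∞ with rfl | hrt
    · exact le_top
    obtain ⟨G, _, hG, hGc⟩ := good r.toReal (ENNReal.toReal_pos hr.ne' hrt)
    rw [ENNReal.ofReal_toReal hrt] at hG
    refine (measure_mono fun ω hω => ?_).trans hG
    intro hωG
    refine hω (cauchySeq_tendsto_of_complete (Metric.cauchySeq_iff.2 fun δ hδ => ?_))
    obtain ⟨N, hN⟩ := hGc (δ / 2) (half_pos hδ)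
    refine ⟨N, fun m hm n hn => ?_⟩
    rw [dist_eq_norm]
    exact (hN m hm n hn ω hωG).trans_lt (half_lt_self hδ)
  obtain ⟨g₀, hg₀, hlim⟩ := exists_stronglyMeasurable_limit_of_tendsto_ae
    (fun n => (u n).aestronglyMeasurable) hcau
  have hg := AEEqFun.coeFn_mk g₀ hg₀.aestronglyMeasurable (μ := μ)
  set g : Ω →ₘ[μ] ℂ := AEEqFun.mk g₀ hg₀.aestronglyMeasurable
  have hlim' : ∀ᵐ ω ∂μ, Tendsto (fun n => u n ω) atTop (𝓝 (g ω)) := by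
    filter_upwards [hlim, hg] with ω h1 h2
    rwa [h2]
  refine ⟨g, fun ε hε => ?_, hlim'⟩
  obtain ⟨G, hGm, hG, hGc⟩ := good ε hε
  refine ⟨G, hGm, hG, ENNReal.tendsto_nhds_zero.2 fun δ hδ => ?_⟩
  rcases eq_or_ne δ ∞ with rfl | hδt
  · exact Eventually.of_forall fun _ => le_top
  obtain ⟨N, hN⟩ := hGc δ.toReal (ENNReal.toReal_pos hδ.ne' hδt)
  refine eventually_atTop.2 ⟨N, fun n hn => ?_⟩
  rw [← ENNReal.ofReal_toReal hδt, eLpNorm_top_le_iff ENNReal.toReal_nonneg]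
  filter_upwards [hlim'] with ω hω
  by_cases hωG : ω ∈ G
  · rw [indicator_of_mem hωG]
    refine le_of_tendsto (hω.sub_const (u n ω)).norm (eventually_atTop.2 ⟨N, fun m hm => ?_⟩)
    exact hN m hm n hn ω hωG
  · rw [indicator_of_notMem hωG, norm_zero]
    exact ENNReal.toReal_nonneg

end AlmostUniform

/-! ### Convergence on `L² ∩ L^∞` and for functions with finite tails. -/

section Convergence

variable {Ω : Type*} [MeasurableSpace Ω] {μ : Measure Ω}

/-- Pointwise, `(x - c)⁺ ≤ x² / c` for `x ≥ 0`. -/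
theorem tail_le_eLpNorm_two_sq (f : Ω →ₘ[μ] ℂ) {c : ℝ} (hc : 0 < c) :
    tail μ f c ≤ (ENNReal.ofReal c)⁻¹ * eLpNorm f 2 μ ^ 2 := by
  have h2 : eLpNorm f 2 μ ^ 2 = ∫⁻ ω, ‖f ω‖ₑ ^ 2 ∂μ := by
    rw [eLpNorm_eq_lintegral_rpow_enorm_toReal (by norm_num) (by norm_num), ← ENNReal.rpow_natCast,
      ← ENNReal.rpow_mul]
    norm_num
  have hne : (ENNReal.ofReal c)⁻¹ ≠ ∞ := ENNReal.inv_ne_top.2 (by simpa using hc)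
  rw [h2, ← lintegral_const_mul' _ _ hne]
  refine lintegral_mono fun ω => ?_
  rw [← ofReal_norm, ← ENNReal.ofReal_inv_of_pos hc, ← ENNReal.ofReal_pow (norm_nonneg _),
    ← ENNReal.ofReal_mul (by positivity)]
  refine ENNReal.ofReal_le_ofReal ?_
  rw [inv_mul_eq_div, le_div_iff₀ hc]
  nlinarith [sq_nonneg (‖f ω‖ - c), norm_nonneg (f ω), mul_nonneg (norm_nonneg (f ω)) hc.le]

theorem mem_L1addLinf_of_mem_L2 (f : Lp ℂ 2 μ) : f.1 ∈ L1addLinf μ := by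
  refine mem_L1addLinf_iff.2 ⟨1, zero_le_one, (tail_le_eLpNorm_two_sq f.1 one_pos).trans_lt ?_⟩
  exact ENNReal.mul_lt_top (by simp) (ENNReal.pow_lt_top (Lp.mem_Lp_iff_eLpNorm_lt_top.1 f.2))

/-- The inclusion of `L²` into `L¹ + L^∞`. -/
noncomputable def L2incl (μ : Measure Ω) : Lp ℂ 2 μ →ₗ[ℂ] L1addLinf μ where
  toFun f := ⟨f.1, mem_L1addLinf_of_mem_L2 f⟩
  map_add' _ _ := rfl
  map_smul' _ _ := rfl

variable {T : Module.End ℂ (L1addLinf μ)}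

theorem IsDunfordSchwartz.eLpNorm_two_le (hT : IsDunfordSchwartz μ T) (f : L1addLinf μ) :
    eLpNorm (T f).1 2 μ ≤ eLpNorm f.1 2 μ :=
  SymmErgodic.eLpNorm_two_le fun _ hc => hT.tail_le f hc

/-- A Dunford-Schwartz operator restricts to a contraction of `L²`. -/
noncomputable def IsDunfordSchwartz.toL2 (hT : IsDunfordSchwartz μ T) :
    Lp ℂ 2 μ →L[ℂ] Lp ℂ 2 μ :=
  LinearMap.mkContinuous
    { toFun := fun f => ⟨(T (L2incl μ f)).1, Lp.mem_Lp_iff_eLpNorm_lt_top.2 <|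
        (hT.eLpNorm_two_le _).trans_lt (Lp.mem_Lp_iff_eLpNorm_lt_top.1 f.2)⟩
      map_add' := fun f g => Subtype.ext <| congrArg (fun u : L1addLinf μ => u.1)
        ((congrArg T (map_add (L2incl μ) f g)).trans (map_add T _ _))
      map_smul' := fun z f => Subtype.ext <| congrArg (fun u : L1addLinf μ => u.1)
        ((congrArg T (map_smul (L2incl μ) z f)).trans (map_smul T _ _)) } 1 <| by
    intro f
    rw [one_mul]
    exact ENNReal.toReal_mono (Lp.mem_Lp_iff_eLpNorm_lt_top.1 f.2).ne (hT.eLpNorm_two_le _)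

theorem IsDunfordSchwartz.norm_toL2_le (hT : IsDunfordSchwartz μ T) : ‖hT.toL2‖ ≤ 1 :=
  LinearMap.mkContinuous_norm_le _ zero_le_one _

theorem IsDunfordSchwartz.L2incl_toL2 (hT : IsDunfordSchwartz μ T) (f : Lp ℂ 2 μ) :
    L2incl μ (hT.toL2 f) = T (L2incl μ f) := rfl

theorem IsDunfordSchwartz.L2incl_toL2_iterate (hT : IsDunfordSchwartz μ T) (f : Lp ℂ 2 μ) (k : ℕ) :
    L2incl μ (hT.toL2^[k] f) = (T ^ k) (L2incl μ f) := by
  induction k with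
  | zero => rfl
  | succ k ih =>
    rw [Function.iterate_succ_apply', hT.L2incl_toL2, ih, pow_succ', Module.End.mul_apply]

/-- Von Neumann's mean ergodic theorem for a contraction of `L²`; the limit is the projection onto
the fixed vectors. -/
theorem IsDunfordSchwartz.exists_tendsto_birkhoffAverage (hT : IsDunfordSchwartz μ T)
    (x : Lp ℂ 2 μ) : ∃ p : Lp ℂ 2 μ, hT.toL2 p = p ∧
      Tendsto (fun n => birkhoffAverage ℂ hT.toL2 id n x) atTop (𝓝 p) :=
  ⟨_, (((hT.toL2).eqLocus (1 : Lp ℂ 2 μ →L[ℂ] Lp ℂ 2 μ)).orthogonalProjectionOnto x).2,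
    (hT.toL2).tendsto_birkhoffAverage_orthogonalProjection hT.norm_toL2_le x⟩

theorem weightedAvg_one_eq (T : Module.End ℂ (L1addLinf μ)) (f : L1addLinf μ) (n : ℕ) :
    weightedAvg μ T (fun _ => 1) f n = (n : ℂ)⁻¹ • ∑ k ∈ Finset.range n, (T ^ k) f := by
  simp [weightedAvg]

theorem IsDunfordSchwartz.L2incl_birkhoffAverage (hT : IsDunfordSchwartz μ T) (f : Lp ℂ 2 μ)
    (n : ℕ) : L2incl μ (birkhoffAverage ℂ hT.toL2 id n f) =
      weightedAvg μ T (fun _ => 1) (L2incl μ f) n := by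
  rw [weightedAvg_one_eq, birkhoffAverage, birkhoffSum, map_smul, map_sum]
  simp only [id, hT.L2incl_toL2_iterate]

/-! ### Coboundaries and averages. -/

section Telescoping

variable {V : Type*} [AddCommGroup V] [Module ℂ V]

/-- Sums along the orbit of a coboundary telescope. -/
theorem sum_pow_sub_apply (A : Module.End ℂ V) (y : V) (n : ℕ) :
    ∑ k ∈ Finset.range n, (A ^ k) (y - A y) = y - (A ^ n) y := by
  have := Finset.sum_range_sub' (fun k => (A ^ k) y) n
  rw [pow_zero, Module.End.one_apply] at this
  rw [← this]
  refine Finset.sum_congr rfl fun k _ => ?_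
  rw [map_sub, pow_succ, Module.End.mul_apply]

/-- The primitive of `f` whose coboundary is the difference of `f` and its average. -/
noncomputable def averagePrimitive (A : Module.End ℂ V) (f : V) (n : ℕ) : V :=
  (n : ℂ)⁻¹ • ∑ k ∈ Finset.range n, ∑ i ∈ Finset.range k, (A ^ i) f

/-- The difference of a vector and its average is a coboundary. -/
theorem eq_average_add_coboundary (A : Module.End ℂ V) (f : V) {n : ℕ} (hn : 0 < n) :
    f = (n : ℂ)⁻¹ • ∑ k ∈ Finset.range n, (A ^ k) f +
      (averagePrimitive A f n - A (averagePrimitive A f n)) := by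
  have hn' : (n : ℂ) ≠ 0 := by exact_mod_cast hn.ne'
  have key : ∀ k, ∑ i ∈ Finset.range k, (A ^ i) f - A (∑ i ∈ Finset.range k, (A ^ i) f) =
      f - (A ^ k) f := by
    intro k
    rw [← sum_pow_sub_apply, map_sum, ← Finset.sum_sub_distrib]
    refine Finset.sum_congr rfl fun i _ => ?_
    rw [map_sub, ← Module.End.mul_apply, ← Module.End.mul_apply, ← pow_succ, ← pow_succ']
  rw [averagePrimitive, map_smul, ← smul_sub, map_sum, ← Finset.sum_sub_distrib,
    Finset.sum_congr rfl fun k _ => key k, Finset.sum_sub_distrib, smul_sub, Finset.sum_const,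
    Finset.card_range, ← Nat.cast_smul_eq_nsmul ℂ, inv_smul_smul₀ hn']
  abel

end Telescoping

theorem eq_weightedAvg_one_add_coboundary (T : Module.End ℂ (L1addLinf μ)) (f : L1addLinf μ) {n : ℕ}
    (hn : 0 < n) : f = weightedAvg μ T (fun _ => 1) f n +
      (averagePrimitive T f n - T (averagePrimitive T f n)) := by
  have h := eq_average_add_coboundary T f hn
  refine h.trans ?_
  rw [weightedAvg_one_eq]

theorem IsDunfordSchwartz.eLpNorm_top_pow_le (hT : IsDunfordSchwartz μ T) {f : L1addLinf μ} {M : ℝ}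
    (hM : 0 ≤ M) (hf : eLpNorm f.1 ∞ μ ≤ ENNReal.ofReal M) :
    ∀ᵐ ω ∂μ, ∀ k, ‖((T ^ k) f).1 ω‖ ≤ M :=
  ae_all_iff.2 fun k => (eLpNorm_top_le_iff hM).1 (((hT.pow k) f).2.trans hf)

/-- A finite combination of bounded iterates. The bound may grow with `n`, but `n` is fixed before
the averages of the coboundary are taken. -/
theorem IsDunfordSchwartz.eLpNorm_top_averagePrimitive (hT : IsDunfordSchwartz μ T)
    {f : L1addLinf μ} (hf : eLpNorm f.1 ∞ μ < ∞) (n : ℕ) :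
    eLpNorm (averagePrimitive T f n).1 ∞ μ < ∞ := by
  have hmem : (averagePrimitive T f n).1 ∈ Lp.LpSubmodule ℂ ℂ ∞ μ := by
    rw [averagePrimitive, Submodule.coe_smul, Submodule.coe_sum]
    refine Submodule.smul_mem _ _ (Submodule.sum_mem _ fun k _ => ?_)
    rw [Submodule.coe_sum]
    exact Submodule.sum_mem _ fun i _ =>
      Lp.mem_Lp_iff_eLpNorm_lt_top.2 (((hT.pow i) f).2.trans_lt hf)
  exact Lp.mem_Lp_iff_eLpNorm_lt_top.1 hmem

/-- Averages of the sum of a fixed vector and a bounded coboundary. -/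
theorem IsDunfordSchwartz.cauchyAU_fixed_add_coboundary (hT : IsDunfordSchwartz μ T)
    {p y : L1addLinf μ} (hp : T p = p) (hy : eLpNorm y.1 ∞ μ < ∞) :
    CauchyAU μ fun n => (weightedAvg μ T (fun _ => 1) (p + (y - T y)) n).1 := by
  obtain ⟨M, hM0, hM⟩ : ∃ M : ℝ, 0 ≤ M ∧ eLpNorm y.1 ∞ μ ≤ ENNReal.ofReal M :=
    ⟨_, ENNReal.toReal_nonneg, (ENNReal.ofReal_toReal hy.ne).ge⟩
  refine CauchyAU.of_ae_le (f := p.1) (b := fun n => 2 * M / n)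
    (tendsto_const_div_atTop_nhds_zero_nat _) ?_
  have hpow : ∀ k, (T ^ k) p = p := by
    intro k
    induction k with
    | zero => rfl
    | succ k ih => rw [pow_succ, Module.End.mul_apply, hp, ih]
  have hav : ∀ n : ℕ, 0 < n → weightedAvg μ T (fun _ => 1) (p + (y - T y)) n =
      p + (n : ℂ)⁻¹ • (y - (T ^ n) y) := by
    intro n hn
    have hn' : (n : ℂ) ≠ 0 := by exact_mod_cast hn.ne'
    have e : ∑ k ∈ Finset.range n, (T ^ k) (y - T y) = y - (T ^ n) y := sum_pow_sub_apply T y n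
    rw [weightedAvg_add, weightedAvg_one_eq, weightedAvg_one_eq, e]
    simp only [hpow, Finset.sum_const, Finset.card_range]
    rw [← Nat.cast_smul_eq_nsmul ℂ, inv_smul_smul₀ hn']
  refine ae_all_iff.2 fun n => ?_
  rcases Nat.eq_zero_or_pos n with rfl | hn
  · exact ae_of_all _ fun _ h => absurd h (lt_irrefl _)
  rw [hav n hn]
  filter_upwards [hT.eLpNorm_top_pow_le hM0 hM,
    AEEqFun.coeFn_add p.1 ((n : ℂ)⁻¹ • (y - (T ^ n) y) : L1addLinf μ).1,
    AEEqFun.coeFn_smul ((n : ℂ)⁻¹) (y - (T ^ n) y : L1addLinf μ).1,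
    AEEqFun.coeFn_sub y.1 ((T ^ n) y).1] with ω h1 h2 h3 h4 _
  rw [Submodule.coe_add, h2, Pi.add_apply, add_sub_cancel_left, Submodule.coe_smul, h3,
    Pi.smul_apply, Submodule.coe_sub, h4, Pi.sub_apply, norm_smul, norm_inv, Complex.norm_natCast,
    inv_mul_eq_div]
  gcongr
  have h10 : ‖y.1 ω‖ ≤ M := h1 0
  linarith [norm_sub_le (y.1 ω) (((T ^ n) y).1 ω), h1 n]

/-- The maximal inequality at level `ε / 2` and the `L²` bound on tails each contribute a factor `2
/ ε`; the smallness of `e` leaves `(min 1 ε)² ≤ ε`. -/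
theorem IsDunfordSchwartz.maximal_L2 (hT : IsDunfordSchwartz μ T) (e : Lp ℂ 2 μ) {ε : ℝ}
    (hε : 0 < ε) (he : ‖e‖ < ε / 2 * min 1 ε) :
    μ {ω | ∃ n, ε < ‖(weightedAvg μ T (fun _ => 1) (L2incl μ e) n).1 ω‖} ≤ ENNReal.ofReal ε := by
  have hbad := hT.maximal (β := fun _ => 1) (C := 1) (by simp) (L2incl μ e) (half_pos hε)
  rw [show 2 * 1 * (ε / 2) = ε by ring] at hbad
  refine hbad.trans ?_
  have hε2 : 0 < ε / 2 := half_pos hε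
  have e1 : eLpNorm (L2incl μ e).1 2 μ = ENNReal.ofReal ‖e‖ := by
    rw [Lp.norm_def, ENNReal.ofReal_toReal (Lp.eLpNorm_ne_top e)]
    rfl
  have htail := tail_le_eLpNorm_two_sq (L2incl μ e).1 hε2
  rw [e1] at htail
  refine (mul_le_mul_right htail _).trans ?_
  rw [← ENNReal.ofReal_inv_of_pos hε2, ← ENNReal.ofReal_pow (norm_nonneg _),
    ← ENNReal.ofReal_mul (by positivity), ← ENNReal.ofReal_mul (by positivity)]
  refine ENNReal.ofReal_le_ofReal ?_
  have h1 : ‖e‖ ^ 2 ≤ (ε / 2 * min 1 ε) ^ 2 := by gcongr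
  have h2 : (min 1 ε) ^ 2 ≤ ε := by
    rcases le_total 1 ε with h | h
    · rw [min_eq_left h]; simpa using h
    · rw [min_eq_right h]; nlinarith
  calc (ε / 2)⁻¹ * ((ε / 2)⁻¹ * ‖e‖ ^ 2)
      ≤ (ε / 2)⁻¹ * ((ε / 2)⁻¹ * (ε / 2 * min 1 ε) ^ 2) := by gcongr
    _ = (min 1 ε) ^ 2 := by field_simp
    _ ≤ ε := h2

/-- If `f = u + v`, the difference of the averages of `f` and `v` is the average of `u`. -/
theorem weightedAvg_sub_ae (β : ℕ → ℂ) {f u v : L1addLinf μ} (h : f = u + v) :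
    ∀ᵐ ω ∂μ, ∀ n, (weightedAvg μ T β f n).1 ω - (weightedAvg μ T β v n).1 ω =
      (weightedAvg μ T β u n).1 ω := by
  refine ae_all_iff.2 fun n => ?_
  rw [h, weightedAvg_add]
  filter_upwards [AEEqFun.coeFn_add (weightedAvg μ T β u n).1 (weightedAvg μ T β v n).1] with ω h
  rw [Submodule.coe_add, h, Pi.add_apply, add_sub_cancel_right]

/-- With `q` the `n`-th average of `x` and `p` the mean ergodic limit, `x - q` is a coboundary, and
`q - p` is small for large `n`. -/
theorem IsDunfordSchwartz.exists_approx_fixed_add_coboundary (hT : IsDunfordSchwartz μ T)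
    (x : Lp ℂ 2 μ) (hx : eLpNorm x.1 ∞ μ < ∞) {δ : ℝ} (hδ : 0 < δ) :
    ∃ (e : Lp ℂ 2 μ) (p y : L1addLinf μ), ‖e‖ < δ ∧ T p = p ∧ eLpNorm y.1 ∞ μ < ∞ ∧
      L2incl μ x = L2incl μ e + (p + (y - T y)) := by
  obtain ⟨p, hp, hlim⟩ := hT.exists_tendsto_birkhoffAverage x
  have hpT : T (L2incl μ p) = L2incl μ p := by
    rw [← hT.L2incl_toL2]
    exact congrArg (L2incl μ) hp
  have hlim' := tendsto_iff_norm_sub_tendsto_zero.1 hlim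
  obtain ⟨n, hn, hn0⟩ := ((hlim'.eventually (gt_mem_nhds hδ)).and (eventually_gt_atTop 0)).exists
  have key := eq_weightedAvg_one_add_coboundary T (L2incl μ x) hn0
  rw [← hT.L2incl_birkhoffAverage] at key
  have hy := hT.eLpNorm_top_averagePrimitive (f := L2incl μ x) hx n
  generalize averagePrimitive T (L2incl μ x) n = y at key hy
  generalize birkhoffAverage ℂ hT.toL2 id n x = q at key hn
  refine ⟨q - p, L2incl μ p, y, hn, hpT, hy, ?_⟩
  rw [← add_assoc, ← map_add, sub_add_cancel]
  exact key

/-- The unweighted averages of bounded square integrable functions are almost uniformly Cauchy. -/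
theorem IsDunfordSchwartz.cauchyAU_one (hT : IsDunfordSchwartz μ T) (x : Lp ℂ 2 μ)
    (hx : eLpNorm x.1 ∞ μ < ∞) :
    CauchyAU μ fun n => (weightedAvg μ T (fun _ => 1) (L2incl μ x) n).1 := by
  refine CauchyAU.of_approx fun ε hε => ?_
  have hpos : 0 < ε / 2 * min 1 ε := by positivity
  obtain ⟨e, p, y, he, hp, hy, hdec⟩ := hT.exists_approx_fixed_add_coboundary x hx hpos
  refine ⟨_, hT.cauchyAU_fixed_add_coboundary hp hy, 0,
    le_trans (measure_mono_ae ?_) (hT.maximal_L2 e hε he)⟩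
  filter_upwards [weightedAvg_sub_ae (T := T) (fun _ => 1) hdec] with ω h ⟨n, _, hn⟩
  exact ⟨n, by rwa [← h n]⟩

/-- The powers of `l` are absorbed into the operator: `l • T` is again Dunford–Schwartz, and its
unweighted averages are the averages in question. -/
theorem IsDunfordSchwartz.cauchyAU_circle (hT : IsDunfordSchwartz μ T) (l : Circle) (x : Lp ℂ 2 μ)
    (hx : eLpNorm x.1 ∞ μ < ∞) :
    CauchyAU μ fun n => (weightedAvg μ T (fun k => (l : ℂ) ^ k) (L2incl μ x) n).1 := by
  have h := (hT.smul (Circle.norm_coe l)).cauchyAU_one x hx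
  have heq : ∀ n, weightedAvg μ ((l : ℂ) • T) (fun _ => 1) (L2incl μ x) n =
      weightedAvg μ T (fun k => (l : ℂ) ^ k) (L2incl μ x) n := by
    intro n
    simp [weightedAvg, smul_pow]
  simpa only [heq] using h

theorem IsDunfordSchwartz.cauchyAU_trigPoly (hT : IsDunfordSchwartz μ T) {P : ℤ → ℂ}
    (hP : IsTrigPoly P) (x : Lp ℂ 2 μ) (hx : eLpNorm x.1 ∞ μ < ∞) :
    CauchyAU μ fun n => (weightedAvg μ T (fun k => P k) (L2incl μ x) n).1 := by
  obtain ⟨s, z, l, hP⟩ := hP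
  have h := CauchyAU.sum Finset.univ fun j _ =>
    (hT.cauchyAU_circle (l j) x hx).const_smul (z j)
  have heq : ∀ n, weightedAvg μ T (fun k => P k) (L2incl μ x) n =
      ∑ j, z j • weightedAvg μ T (fun k => (l j : ℂ) ^ k) (L2incl μ x) n := by
    intro n
    simp only [weightedAvg, hP, zpow_natCast, Finset.sum_smul, Finset.smul_sum, smul_smul]
    rw [Finset.sum_comm]
    refine Finset.sum_congr rfl fun j _ => Finset.sum_congr rfl fun k _ => ?_
    congr 1
    ring
  simp only [heq, Submodule.coe_sum, Submodule.coe_smul]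
  exact h

theorem IsTrigPoly.exists_bound {P : ℤ → ℂ} (hP : IsTrigPoly P) : ∃ C : ℝ, ∀ k, ‖P k‖ ≤ C := by
  obtain ⟨s, z, l, hP⟩ := hP
  refine ⟨∑ j, ‖z j‖, fun k => ?_⟩
  rw [hP]
  refine (norm_sum_le _ _).trans (Finset.sum_le_sum fun j _ => ?_)
  rw [norm_mul, norm_zpow, Circle.norm_coe, one_zpow, mul_one]

/-- A real-valued `limsup` carries no information for sequences unbounded above; boundedness of `β`
and `P` makes the estimate eventual. -/
theorem IsBoundedBesicovitch.exists_eventually_lt {β : ℕ → ℂ} (hβ : IsBoundedBesicovitch β) {ε : ℝ}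
    (hε : 0 < ε) : ∃ P : ℤ → ℂ, IsTrigPoly P ∧
      ∀ᶠ n : ℕ in atTop, (1 / (n : ℝ)) * ∑ k ∈ Finset.range n, ‖β k - P k‖ < ε := by
  obtain ⟨⟨C, hC⟩, h⟩ := hβ
  obtain ⟨P, hP, hlim⟩ := h ε hε
  obtain ⟨D, hD⟩ := hP.exists_bound
  refine ⟨P, hP, eventually_lt_of_limsup_lt hlim ?_⟩
  refine isBoundedUnder_of ⟨C + D, fun n => ?_⟩
  have h0 : 0 ≤ C + D := add_nonneg ((norm_nonneg _).trans (hC 0)) ((norm_nonneg _).trans (hD 0))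
  rcases Nat.eq_zero_or_pos n with rfl | hn
  · simpa using h0
  have hn' : (0 : ℝ) < n := by exact_mod_cast hn
  rw [one_div, inv_mul_le_iff₀ hn']
  calc ∑ k ∈ Finset.range n, ‖β k - P k‖ ≤ ∑ k ∈ Finset.range n, (C + D) :=
        Finset.sum_le_sum fun k _ => (norm_sub_le _ _).trans (add_le_add (hC k) (hD k))
    _ = n * (C + D) := by rw [Finset.sum_const, Finset.card_range, nsmul_eq_mul]

theorem IsDunfordSchwartz.cauchyAU_L2 (hT : IsDunfordSchwartz μ T) {β : ℕ → ℂ}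
    (hβ : IsBoundedBesicovitch β) (x : Lp ℂ 2 μ) (hx : eLpNorm x.1 ∞ μ < ∞) :
    CauchyAU μ fun n => (weightedAvg μ T β (L2incl μ x) n).1 := by
  refine CauchyAU.of_approx fun ε hε => ?_
  set M := (eLpNorm x.1 ∞ μ).toReal
  have hM0 : 0 ≤ M := ENNReal.toReal_nonneg
  have hM : eLpNorm (L2incl μ x).1 ∞ μ ≤ ENNReal.ofReal M := (ENNReal.ofReal_toReal hx.ne).ge
  obtain ⟨P, hP, hPβ⟩ := hβ.exists_eventually_lt (ε := ε / (M + 1)) (by positivity)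
  obtain ⟨N, hN⟩ := eventually_atTop.1 hPβ
  -- For `n ≥ N` the two averages differ by at most `M` times the mean of `|β - P|`, hence by at
  -- most `ε` almost everywhere; the exceptional set is null.
  refine ⟨_, hT.cauchyAU_trigPoly hP x hx, N, le_of_eq_of_le ?_ zero_le⟩
  have h0 : ∀ᵐ ω ∂μ, ¬ ∃ n ≥ N, ε < ‖(weightedAvg μ T β (L2incl μ x) n).1 ω -
      (weightedAvg μ T (fun k => P k) (L2incl μ x) n).1 ω‖ := by
    filter_upwards [hT.eLpNorm_top_pow_le hM0 hM,
      ae_all_iff.2 fun n => coeFn_weightedAvg (T := T) β (L2incl μ x) n,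
      ae_all_iff.2 fun n => coeFn_weightedAvg (T := T) (fun k => P k) (L2incl μ x) n]
      with ω h1 h2 h3 ⟨n, hn, hlt⟩
    rw [h2 n, h3 n, ← mul_sub, ← Finset.sum_sub_distrib, norm_mul, norm_div, norm_one,
      Complex.norm_natCast] at hlt
    refine absurd hlt (not_lt.2 ?_)
    have h4 := (hN n hn).le
    rw [le_div_iff₀ (by positivity)] at h4
    refine le_trans ?_ h4
    rw [mul_assoc]
    refine mul_le_mul_of_nonneg_left ?_ (by positivity)
    rw [Finset.sum_mul]
    refine (norm_sum_le _ _).trans (Finset.sum_le_sum fun k _ => ?_)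
    rw [← sub_mul, norm_mul]
    have := h1 k
    gcongr
    linarith
  simpa [ae_iff] using h0

/-- The space `R_μ`: all `f` in `L¹ + L^∞` whose rearrangement vanishes at infinity. -/
def FiniteTails (μ : Measure Ω) (f : Ω →ₘ[μ] ℂ) : Prop := ∀ c : ℝ, 0 < c → tail μ f c < ∞

theorem FiniteTails.mem_L1addLinf {f : Ω →ₘ[μ] ℂ} (hf : FiniteTails μ f) : f ∈ L1addLinf μ :=
  mem_L1addLinf_iff.2 ⟨1, zero_le_one, hf 1 one_pos⟩

theorem FiniteTails.tendsto_tail {f : Ω →ₘ[μ] ℂ} (hf : FiniteTails μ f) :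
    Tendsto (fun n : ℕ => tail μ f n) atTop (𝓝 0) := by
  have h := tendsto_lintegral_filter_of_dominated_convergence (μ := μ) (l := atTop)
    (F := fun (n : ℕ) ω => ENNReal.ofReal (‖f ω‖ - n)) (f := fun _ => 0)
    (fun ω => ENNReal.ofReal (‖f ω‖ - 1))
    (Eventually.of_forall fun n => ((measurable_norm_coe f).sub_const _).ennreal_ofReal)
    ?_ (hf 1 one_pos).ne ?_
  · rw [lintegral_zero] at h
    exact h
  · filter_upwards [eventually_ge_atTop 1] with n hn
    refine ae_of_all _ fun ω => ENNReal.ofReal_le_ofReal ?_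
    have : (1 : ℝ) ≤ n := by exact_mod_cast hn
    linarith
  · refine ae_of_all _ fun ω => ?_
    refine tendsto_const_nhds.congr' ?_
    obtain ⟨N, hN⟩ := exists_nat_ge ‖f ω‖
    filter_upwards [eventually_ge_atTop N] with n hn
    have : (N : ℝ) ≤ n := by exact_mod_cast hn
    exact (ENNReal.ofReal_of_nonpos (by linarith)).symm

/-- A function with finite tails is, up to an error with small tail, bounded and square
integrable. -/
theorem FiniteTails.exists_approx {f : Ω →ₘ[μ] ℂ} (hf : FiniteTails μ f) {c : ℝ} (hc : 0 < c)
    {η : ℝ≥0∞} (hη : 0 < η) : ∃ x : Lp ℂ 2 μ, eLpNorm x.1 ∞ μ < ∞ ∧ tail μ (f - x.1) c ≤ η := by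
  obtain ⟨n, hn, hcn⟩ := ((ENNReal.tendsto_nhds_zero.1 hf.tendsto_tail η hη).and
    (tendsto_natCast_atTop_atTop.eventually_ge_atTop (α := ℕ) c)).exists
  have hn0 : (0 : ℝ) ≤ n := n.cast_nonneg
  -- Only the layer of `f` between the heights `c` and `n` is kept. Then `|x|² ≤ (n + c) (|f| - c)⁺`
  -- is integrable, and `|f - x| ≤ (|f| - n)⁺ + c`.
  set x : Ω →ₘ[μ] ℂ :=
    clipClass (AEEqFun.const Ω (n : ℝ)) f - clipClass (AEEqFun.const Ω c) f with hxdef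
  have hx : ∀ᵐ ω ∂μ, x ω = clip n (f ω) - clip c (f ω) := by
    filter_upwards [AEEqFun.coeFn_sub (clipClass (AEEqFun.const Ω (n : ℝ)) f)
      (clipClass (AEEqFun.const Ω c) f), coeFn_clipClass_const (n : ℝ) f,
      coeFn_clipClass_const c f] with ω h1 h2 h3
    rw [hxdef, h1, Pi.sub_apply, h2, h3]
  have hxz : ∀ z : ℂ, ‖clip n z - clip c z‖ ^ 2 ≤ (n + c) * max (‖z‖ - c) 0 := by
    intro z
    rcases le_total ‖z‖ c with h | h
    · have h1 : ‖z - clip c z‖ = 0 := by rw [norm_sub_clip hc.le, min_eq_left h, sub_self]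
      have h2 : ‖z - clip n z‖ = 0 := by
        rw [norm_sub_clip hn0, min_eq_left (h.trans hcn), sub_self]
      rw [norm_eq_zero, sub_eq_zero] at h1 h2
      rw [← h1, ← h2, sub_self, norm_zero, zero_pow two_ne_zero]
      positivity
    · have h1 : ‖clip n z - clip c z‖ ≤ n + c := by
        refine (norm_sub_le _ _).trans ?_
        rw [norm_clip hn0, norm_clip hc.le]
        exact add_le_add (min_le_right _ _) (min_le_right _ _)
      have h2 : ‖clip n z - clip c z‖ ≤ ‖z‖ - c := by
        have hcl : clip n z - clip c z = (min 1 (n / ‖z‖) - min 1 (c / ‖z‖) : ℝ) • z := by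
          rw [clip, clip, sub_smul]
        have hzpos : 0 < ‖z‖ := hc.trans_le h
        have hmono : min 1 (c / ‖z‖) ≤ min 1 (n / ‖z‖) := by gcongr
        rw [hcl, norm_smul, Real.norm_of_nonneg (sub_nonneg.2 hmono), sub_mul,
          min_eq_right ((div_le_one hzpos).2 h), div_mul_cancel₀ _ hzpos.ne']
        nlinarith [min_le_left 1 (n / ‖z‖)]
      rw [sq]
      gcongr
      exact h2.trans (le_max_left _ _)
  have hx2 : eLpNorm x 2 μ < ∞ := by
    rw [eLpNorm_lt_top_iff_lintegral_rpow_enorm_lt_top (by norm_num) (by norm_num)]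
    refine lt_of_le_of_lt (b := ENNReal.ofReal (n + c) * tail μ f c) ?_
      (ENNReal.mul_lt_top ENNReal.ofReal_lt_top (hf c hc))
    rw [tail, ← lintegral_const_mul' _ _ ENNReal.ofReal_ne_top]
    refine lintegral_mono_ae ?_
    filter_upwards [hx] with ω hω
    rw [hω, ← ofReal_norm, ENNReal.ofReal_rpow_of_nonneg (norm_nonneg _) (by norm_num),
      ← ENNReal.ofReal_mul (by positivity)]
    have := hxz (f ω)
    rcases le_total (‖f ω‖ - c) 0 with h | h
    · rw [max_eq_right h, mul_zero] at this
      rw [ENNReal.ofReal_of_nonpos (by simpa using this)]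
      exact zero_le
    · rw [max_eq_left h] at this
      exact ENNReal.ofReal_le_ofReal (by simpa using this)
  refine ⟨⟨x, Lp.mem_Lp_iff_eLpNorm_lt_top.2 hx2⟩, ?_, ?_⟩
  · refine lt_of_le_of_lt (b := ENNReal.ofReal (n + c)) ?_ ENNReal.ofReal_lt_top
    rw [eLpNorm_top_le_iff (by positivity)]
    filter_upwards [hx] with ω hω
    change ‖x ω‖ ≤ _
    rw [hω]
    refine (norm_sub_le _ _).trans ?_
    rw [norm_clip hn0, norm_clip hc.le]
    exact add_le_add (min_le_right _ _) (min_le_right _ _)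
  · refine le_trans (lintegral_mono_ae ?_) hn
    filter_upwards [hx, AEEqFun.coeFn_sub f x] with ω h1 h2
    change ENNReal.ofReal (‖(f - x) ω‖ - c) ≤ _
    rw [h2, Pi.sub_apply, h1]
    have e1 : f ω - (clip n (f ω) - clip c (f ω)) = (f ω - clip n (f ω)) + clip c (f ω) := by ring
    have e2 := norm_add_le (f ω - clip n (f ω)) (clip c (f ω))
    rw [norm_sub_clip hn0, norm_clip hc.le] at e2
    rw [e1]
    rcases le_total ‖f ω‖ n with h | h
    · rw [min_eq_left h] at e2
      rw [ENNReal.ofReal_of_nonpos (by linarith [min_le_right ‖f ω‖ c])]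
      exact zero_le
    · rw [min_eq_right h] at e2
      exact ENNReal.ofReal_le_ofReal (by linarith [min_le_right ‖f ω‖ c])

theorem IsDunfordSchwartz.cauchyAU (hT : IsDunfordSchwartz μ T) {β : ℕ → ℂ}
    (hβ : IsBoundedBesicovitch β) {f : L1addLinf μ} (hf : FiniteTails μ f.1) :
    CauchyAU μ fun n => (weightedAvg μ T β f n).1 := by
  refine CauchyAU.of_approx fun ε hε => ?_
  obtain ⟨C, hC⟩ : ∃ C : ℝ, 0 < C ∧ ∀ k, ‖β k‖ ≤ C := by
    obtain ⟨C, hC⟩ := hβ.1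
    exact ⟨max C 1, by positivity, fun k => (hC k).trans (le_max_left _ _)⟩
  -- At level `ε / (2 * C)` the threshold of `maximal` is `ε`. A tail of the error of at most this
  -- level times `ε` makes the exceptional set of measure at most `ε`.
  have hlam : 0 < ε / (2 * C) := div_pos hε (by linarith [hC.1])
  have hη : 0 < ENNReal.ofReal (ε / (2 * C)) * ENNReal.ofReal ε := by
    rw [← ENNReal.ofReal_mul hlam.le]
    exact ENNReal.ofReal_pos.2 (mul_pos hlam hε)
  obtain ⟨x, hx, htail⟩ := hf.exists_approx hlam hη
  refine ⟨_, hT.cauchyAU_L2 hβ x hx, 0, ?_⟩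
  have hbad := hT.maximal hC.2 (f - L2incl μ x) hlam
  have e : 2 * C * (ε / (2 * C)) = ε := by
    have := hC.1.ne'
    field_simp
  rw [e] at hbad
  refine le_trans (measure_mono_ae ?_) (hbad.trans ?_)
  · filter_upwards [weightedAvg_sub_ae (T := T) β (sub_add_cancel f (L2incl μ x)).symm]
      with ω h ⟨n, _, hn⟩
    exact ⟨n, by rwa [← h n]⟩
  · refine (mul_le_mul_right htail _).trans ?_
    rw [← mul_assoc, ENNReal.inv_mul_cancel (by simpa using hlam) ENNReal.ofReal_ne_top, one_mul]

theorem tail_smul (f : Ω →ₘ[μ] ℂ) {C : ℝ} (hC : 0 < C) (c : ℝ) :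
    tail μ ((C : ℂ) • f) c = ENNReal.ofReal C * tail μ f (c / C) := by
  rw [tail, tail, ← lintegral_const_mul' _ _ ENNReal.ofReal_ne_top]
  refine lintegral_congr_ae ?_
  filter_upwards [AEEqFun.coeFn_smul (C : ℂ) f] with ω hω
  rw [hω, Pi.smul_apply, norm_smul, Complex.norm_real, Real.norm_of_nonneg hC.le,
    ← ENNReal.ofReal_mul hC.le, mul_sub, mul_div_cancel₀ _ hC.ne']

theorem FiniteTails.smul {f : Ω →ₘ[μ] ℂ} (hf : FiniteTails μ f) {C : ℝ} (hC : 0 < C) :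
    FiniteTails μ ((C : ℂ) • f) := fun c hc => by
  rw [tail_smul f hC]
  exact ENNReal.mul_lt_top ENNReal.ofReal_lt_top (hf _ (by positivity))

theorem meas_lt_norm_le_tail (f : Ω →ₘ[μ] ℂ) {c d : ℝ} (h : c < d) :
    μ {ω | d < ‖f ω‖} ≤ (ENNReal.ofReal (d - c))⁻¹ * tail μ f c := by
  have hpos : ENNReal.ofReal (d - c) ≠ 0 := by simpa using h
  have h1 := mul_meas_ge_le_lintegral (μ := μ)
    ((measurable_norm_coe f).sub_const c).ennreal_ofReal (ENNReal.ofReal (d - c))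
  calc μ {ω | d < ‖f ω‖} ≤ μ {ω | ENNReal.ofReal (d - c) ≤ ENNReal.ofReal (‖f ω‖ - c)} :=
        measure_mono fun ω hω => ENNReal.ofReal_le_ofReal (by
          have : d < ‖f ω‖ := hω
          linarith)
    _ = (ENNReal.ofReal (d - c))⁻¹ * (ENNReal.ofReal (d - c) *
          μ {ω | ENNReal.ofReal (d - c) ≤ ENNReal.ofReal (‖f ω‖ - c)}) := by
        rw [← mul_assoc, ENNReal.inv_mul_cancel hpos ENNReal.ofReal_ne_top, one_mul]
    _ ≤ _ := by gcongr; exact h1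

theorem FiniteTails.meas_lt_top {f : Ω →ₘ[μ] ℂ} (hf : FiniteTails μ f) {c : ℝ} (hc : 0 < c) :
    μ {ω | c < ‖f ω‖} < ∞ :=
  (meas_lt_norm_le_tail f (half_lt_self hc)).trans_lt <| ENNReal.mul_lt_top
    (ENNReal.inv_lt_top.2 (ENNReal.ofReal_pos.2 (sub_pos.2 (half_lt_self hc))))
    (hf _ (half_pos hc))

theorem FiniteTails.mem_L0fin {f : Ω →ₘ[μ] ℂ} (hf : FiniteTails μ f) : f ∈ L0fin μ :=
  ⟨1, one_pos, hf.meas_lt_top one_pos⟩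

/-- A criterion for the validity of the weighted ergodic theorem. -/
theorem weightedErgodicTheoremHolds_of {X : Set (Ω →ₘ[μ] ℂ)} (hX : ∀ f ∈ X, FiniteTails μ f)
    (hsmul : ∀ f ∈ X, ∀ C : ℝ, 0 < C → (C : ℂ) • f ∈ X)
    (htail : ∀ f ∈ X, ∀ g, FiniteTails μ g → (∀ c, 0 ≤ c → tail μ g c ≤ tail μ f c) → g ∈ X) :
    WeightedErgodicTheoremHolds μ X := by
  intro β hβ T hT f hf
  have hf' : f ∈ L1addLinf μ := (hX f hf).mem_L1addLinf
  obtain ⟨g, hg, hlim⟩ := (hT.cauchyAU hβ (f := ⟨f, hf'⟩) (hX f hf)).exists_tendstoAU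
  obtain ⟨C, hC, hβC⟩ : ∃ C : ℝ, 0 < C ∧ ∀ k, ‖β k‖ ≤ C := by
    obtain ⟨C, hC⟩ := hβ.1
    exact ⟨max C 1, by positivity, fun k => (hC k).trans (le_max_left _ _)⟩
  have hgf : ∀ c, 0 ≤ c → tail μ g c ≤ tail μ ((C : ℂ) • f) c := by
    intro c hc
    -- Fatou's lemma along the almost everywhere limit; each average then has tail at most that of
    -- `C • f`.
    have hfat : tail μ g c ≤
        liminf (fun n => tail μ (weightedAvg μ T β ⟨f, hf'⟩ n).1 c) atTop := by
      refine le_trans (lintegral_mono_ae ?_) (lintegral_liminf_le fun n =>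
        ((measurable_norm_coe _).sub_const c).ennreal_ofReal)
      filter_upwards [hlim] with ω hω
      exact ((ENNReal.continuous_ofReal.tendsto _).comp
        (hω.norm.sub_const c)).liminf_eq.ge
    rw [tail_smul f hC]
    refine hfat.trans (liminf_le_of_le (by isBoundedDefault) fun b hb => ?_)
    obtain ⟨n, hn⟩ := hb.exists
    refine hn.trans ?_
    have := hT.tail_weightedAvg_le hβC ⟨f, hf'⟩ (c := c / C) (by positivity) n
    rwa [mul_div_cancel₀ _ hC.ne'] at this
  have hCf := hsmul f hf C hC
  exact ⟨hf', g, htail _ hCf g (fun c hc => (hgf c hc.le).trans_lt (hX _ hCf c hc)) hgf, hg⟩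

end Convergence

/-! ### Rearrangements, equimeasurability and submajorization. -/

section Rearrangement

variable {Ω : Type*} [MeasurableSpace Ω] {μ : Measure Ω}

theorem ofReal_lt_enorm_iff {c : ℝ} (hc : 0 ≤ c) (z : ℂ) : ENNReal.ofReal c < ‖z‖ₑ ↔ c < ‖z‖ := by
  rw [← ofReal_norm, ENNReal.ofReal_lt_ofReal_iff_of_nonneg hc]

/-- The infimum defining `f*` is attained, by continuity of `μ` from below. This makes `f*` a
generalized inverse of the distribution function. -/
theorem rearr_le_iff {f : Ω →ₘ[μ] ℂ} {t : ℝ} {y : ℝ≥0∞} :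
    rearr μ f t ≤ y ↔ μ {ω | y < ‖f ω‖ₑ} ≤ ENNReal.ofReal t := by
  constructor
  · intro h
    rcases eq_or_ne y ∞ with rfl | hy
    · simp
    have hU : {ω | y < ‖f ω‖ₑ} = ⋃ n : ℕ, {ω | y + (n + 1 : ℝ≥0∞)⁻¹ < ‖f ω‖ₑ} := by
      ext ω
      simp only [mem_ofPred_eq, mem_iUnion]
      refine ⟨fun hω => ?_, fun ⟨n, hn⟩ => le_self_add.trans_lt hn⟩
      obtain ⟨n, hn⟩ := ENNReal.exists_inv_nat_lt (tsub_pos_of_lt hω).ne'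
      refine ⟨n, lt_of_le_of_lt ?_ (lt_tsub_iff_left.1 hn)⟩
      gcongr
      exact le_self_add
    have hmono : Monotone fun n : ℕ => {ω | y + (n + 1 : ℝ≥0∞)⁻¹ < ‖f ω‖ₑ} := by
      intro m n hmn ω (hω : y + (m + 1 : ℝ≥0∞)⁻¹ < ‖f ω‖ₑ)
      change y + (n + 1 : ℝ≥0∞)⁻¹ < ‖f ω‖ₑ
      refine lt_of_le_of_lt ?_ hω
      gcongr
    rw [hU, hmono.measure_iUnion]
    refine iSup_le fun n => ?_
    have hlt : rearr μ f t < y + (n + 1 : ℝ≥0∞)⁻¹ :=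
      h.trans_lt (ENNReal.lt_add_right hy (ENNReal.inv_ne_zero.2 (by finiteness)))
    obtain ⟨c, hc, hcy⟩ := sInf_lt_iff.1 hlt
    exact (measure_mono fun ω hω => hcy.trans hω).trans hc.2
  · intro h
    refine le_of_forall_gt_imp_ge_of_dense fun c hc => sInf_le ⟨bot_le.trans_lt hc, ?_⟩
    exact (measure_mono fun ω hω => hc.trans hω).trans h

theorem lt_rearr_iff {f : Ω →ₘ[μ] ℂ} {t : ℝ} {y : ℝ≥0∞} :
    y < rearr μ f t ↔ ENNReal.ofReal t < μ {ω | y < ‖f ω‖ₑ} := by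
  rw [← not_le, rearr_le_iff, not_le]

theorem halfLine_lt_rearr (f : Ω →ₘ[μ] ℂ) (y : ℝ≥0∞) :
    halfLine {t | y < rearr μ f t} = μ {ω | y < ‖f ω‖ₑ} := by
  simp only [lt_rearr_iff]
  exact volume_setOf_ofReal_lt _

theorem rearr_smul (f : Ω →ₘ[μ] ℂ) {C : ℝ} (hC : 0 < C) (t : ℝ) :
    rearr μ ((C : ℂ) • f) t = ENNReal.ofReal C * rearr μ f t := by
  have hC0 : ENNReal.ofReal C ≠ 0 := by simpa using hC
  refine eq_of_forall_ge_iff fun y => ?_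
  rw [rearr_le_iff, mul_comm, ← ENNReal.le_div_iff_mul_le (Or.inl hC0) (Or.inl ENNReal.ofReal_ne_top),
    rearr_le_iff]
  have : μ {ω | y < ‖((C : ℂ) • f : Ω →ₘ[μ] ℂ) ω‖ₑ} = μ {ω | y / ENNReal.ofReal C < ‖f ω‖ₑ} := by
    refine measure_congr ?_
    filter_upwards [AEEqFun.coeFn_smul (C : ℂ) f] with ω hω
    refine propext ?_
    change y < _ ↔ y / _ < _
    rw [hω, Pi.smul_apply, enorm_smul, ← ofReal_norm (C : ℂ), Complex.norm_real,
      Real.norm_of_nonneg hC.le, ENNReal.div_lt_iff (Or.inl hC0) (Or.inl ENNReal.ofReal_ne_top),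
      mul_comm]
  rw [this]

theorem rearr_lt_top {f : Ω →ₘ[μ] ℂ} (hf : f ∈ L0fin μ) {t : ℝ} (ht : 0 < t) :
    rearr μ f t < ∞ := by
  obtain ⟨c, hc, hfin⟩ := hf
  have hlim : Tendsto (fun n : ℕ => μ {ω | (n : ℝ) < ‖f ω‖}) atTop (𝓝 0) := by
    have hI : ⋂ n : ℕ, {ω | (n : ℝ) < ‖f ω‖} = ∅ := by
      refine eq_empty_of_forall_notMem fun ω hω => ?_
      obtain ⟨n, hn⟩ := exists_nat_ge ‖f ω‖
      exact not_lt.2 hn (mem_iInter.1 hω n)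
    obtain ⟨N, hN⟩ := exists_nat_ge c
    have := tendsto_measure_iInter_atTop (μ := μ) (s := fun n : ℕ => {ω | (n : ℝ) < ‖f ω‖})
      (fun n => (measurableSet_lt measurable_const (measurable_norm_coe f)).nullMeasurableSet)
      (fun m n hmn ω (hω : (n : ℝ) < ‖f ω‖) => lt_of_le_of_lt (Nat.cast_le.2 hmn) hω)
      ⟨N, ((measure_mono fun ω hω => lt_of_le_of_lt hN hω).trans_lt hfin).ne⟩
    rwa [hI, measure_empty] at this
  obtain ⟨n, hn⟩ := (ENNReal.tendsto_nhds_zero.1 hlim _ (ENNReal.ofReal_pos.2 ht)).exists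
  refine lt_of_le_of_lt (b := ENNReal.ofReal n) (rearr_le_iff.2 ?_) ENNReal.ofReal_lt_top
  simpa only [ofReal_lt_enorm_iff n.cast_nonneg] using hn

theorem enorm_rearrClass {f : Ω →ₘ[μ] ℂ} (hf : f ∈ L0fin μ) :
    ∀ᵐ t ∂halfLine, ‖rearrClass μ f t‖ₑ = rearr μ f t := by
  filter_upwards [AEEqFun.coeFn_mk _ (rearr_aestronglyMeasurable μ f),
    (ae_restrict_mem measurableSet_Ioi : ∀ᵐ t : ℝ ∂halfLine, t ∈ Ioi 0)] with t h1 h2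
  rw [rearrClass, h1, ← ofReal_norm, Complex.norm_real, Real.norm_of_nonneg ENNReal.toReal_nonneg,
    ENNReal.ofReal_toReal (rearr_lt_top hf h2).ne]

theorem distribution_rearrClass {f : Ω →ₘ[μ] ℂ} (hf : f ∈ L0fin μ) (y : ℝ≥0∞) :
    halfLine {t | y < ‖rearrClass μ f t‖ₑ} = μ {ω | y < ‖f ω‖ₑ} := by
  rw [← halfLine_lt_rearr f]
  refine measure_congr (μ := halfLine) ?_
  filter_upwards [enorm_rearrClass hf] with t ht
  refine propext ?_
  change y < _ ↔ y < _
  rw [ht]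

theorem rearr_rearrClass {f : Ω →ₘ[μ] ℂ} (hf : f ∈ L0fin μ) (t : ℝ) :
    rearr halfLine (rearrClass μ f) t = rearr μ f t := by
  simp only [rearr, distribution_rearrClass hf]

theorem rearrClass_mem_L0fin {f : Ω →ₘ[μ] ℂ} (hf : f ∈ L0fin μ) :
    rearrClass μ f ∈ L0fin halfLine := by
  obtain ⟨c, hc, hfin⟩ := hf
  refine ⟨c, hc, ?_⟩
  have := distribution_rearrClass ⟨c, hc, hfin⟩ (ENNReal.ofReal c)
  simp only [ofReal_lt_enorm_iff hc.le] at this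
  rwa [this]

theorem tail_rearrClass {f : Ω →ₘ[μ] ℂ} (hf : f ∈ L0fin μ) {c : ℝ} (hc : 0 ≤ c) :
    tail halfLine (rearrClass μ f) c = tail μ f c := by
  rw [tail_eq_lintegral_distribution, tail_eq_lintegral_distribution]
  refine setLIntegral_congr_fun measurableSet_Ioi fun t ht => ?_
  have := distribution_rearrClass hf (ENNReal.ofReal t)
  simpa only [ofReal_lt_enorm_iff (hc.trans (le_of_lt ht))] using this

/-- From `f* ≤ (f* - c)⁺ + c`. With `le_setLIntegral_rearr`, where `c = f*(s)` gives the reverse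
bound, it identifies `∫₀ˢ f*` as a minimum over `c`. -/
theorem setLIntegral_rearr_le {f : Ω →ₘ[μ] ℂ} (hf : f ∈ L0fin μ) (s : ℝ) {c : ℝ} (hc : 0 ≤ c) :
    ∫⁻ t in Ioc 0 s, rearr μ f t ≤ tail μ f c + ENNReal.ofReal c * ENNReal.ofReal s := by
  have hae : ∀ᵐ t ∂volume.restrict (Ioc 0 s), ‖rearrClass μ f t‖ₑ = rearr μ f t :=
    ae_restrict_of_ae_restrict_of_subset (fun t ht => ht.1) (enorm_rearrClass hf)
  calc ∫⁻ t in Ioc 0 s, rearr μ f t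
      ≤ ∫⁻ t in Ioc 0 s, (ENNReal.ofReal (‖rearrClass μ f t‖ - c) + ENNReal.ofReal c) := by
        refine lintegral_mono_ae ?_
        filter_upwards [hae] with t ht
        rw [← ht, ← ofReal_norm]
        refine le_trans ?_ ENNReal.ofReal_add_le
        rw [sub_add_cancel]
    _ = (∫⁻ t in Ioc 0 s, ENNReal.ofReal (‖rearrClass μ f t‖ - c)) +
          ENNReal.ofReal c * ENNReal.ofReal s := by
        rw [lintegral_add_right _ measurable_const, lintegral_const, Measure.restrict_apply_univ,
          Real.volume_Ioc, sub_zero]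
    _ ≤ tail halfLine (rearrClass μ f) c + ENNReal.ofReal c * ENNReal.ofReal s := by
        gcongr
        exact lintegral_mono_set fun t ht => ht.1
    _ = _ := by rw [tail_rearrClass hf hc]

theorem le_setLIntegral_rearr {f : Ω →ₘ[μ] ℂ} (hf : f ∈ L0fin μ) {s : ℝ} (hs : 0 < s) :
    tail μ f (rearr μ f s).toReal + rearr μ f s * ENNReal.ofReal s ≤
      ∫⁻ t in Ioc 0 s, rearr μ f t := by
  have hfin := rearr_lt_top hf hs
  set c := (rearr μ f s).toReal with hc
  have hcs : ENNReal.ofReal c = rearr μ f s := ENNReal.ofReal_toReal hfin.ne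
  have hae : ∀ᵐ t ∂volume.restrict (Ioc 0 s), ‖rearrClass μ f t‖ₑ = rearr μ f t :=
    ae_restrict_of_ae_restrict_of_subset (fun t ht => ht.1) (enorm_rearrClass hf)
  have h1 : tail halfLine (rearrClass μ f) c ≤
      ∫⁻ t in Ioc 0 s, ENNReal.ofReal (‖rearrClass μ f t‖ - c) := by
    rw [← lintegral_indicator measurableSet_Ioc]
    refine le_trans (lintegral_mono_ae ?_) (lintegral_mono' Measure.restrict_le_self le_rfl)
    filter_upwards [enorm_rearrClass hf,
      (ae_restrict_mem measurableSet_Ioi : ∀ᵐ t : ℝ ∂halfLine, t ∈ Ioi 0)] with t ht ht0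
    by_cases hts : t ≤ s
    · rw [indicator_of_mem (show t ∈ Ioc 0 s from ⟨ht0, hts⟩)]
    · have h2 : ‖rearrClass μ f t‖ₑ ≤ ENNReal.ofReal c := by
        rw [ht, hcs]
        exact rearr_antitone μ f (not_le.1 hts).le
      rw [← ofReal_norm, ENNReal.ofReal_le_ofReal_iff ENNReal.toReal_nonneg] at h2
      rw [ENNReal.ofReal_of_nonpos (by linarith)]
      exact zero_le
  rw [← tail_rearrClass hf ENNReal.toReal_nonneg]
  calc tail halfLine (rearrClass μ f) c + rearr μ f s * ENNReal.ofReal s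
      ≤ (∫⁻ t in Ioc 0 s, ENNReal.ofReal (‖rearrClass μ f t‖ - c)) +
          rearr μ f s * ENNReal.ofReal s := by gcongr
    _ = ∫⁻ t in Ioc 0 s, (ENNReal.ofReal (‖rearrClass μ f t‖ - c) + ENNReal.ofReal c) := by
        rw [lintegral_add_right _ measurable_const, lintegral_const, Measure.restrict_apply_univ,
          Real.volume_Ioc, sub_zero, hcs]
    _ ≤ ∫⁻ t in Ioc 0 s, rearr μ f t := by
        refine lintegral_mono_ae ?_
        filter_upwards [hae, ae_restrict_mem measurableSet_Ioc] with t ht hts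
        have h2 : ENNReal.ofReal c ≤ ‖rearrClass μ f t‖ₑ := by
          rw [ht, hcs]
          exact rearr_antitone μ f hts.2
        rw [← ofReal_norm, ENNReal.ofReal_le_ofReal_iff (norm_nonneg _)] at h2
        rw [← ENNReal.ofReal_add (by linarith) ENNReal.toReal_nonneg, sub_add_cancel, ofReal_norm,
          ht]

/-- Tail domination implies submajorization. -/
theorem setLIntegral_rearr_mono {f g : Ω →ₘ[μ] ℂ} (hf : f ∈ L0fin μ) (hg : g ∈ L0fin μ)
    (h : ∀ c, 0 ≤ c → tail μ g c ≤ tail μ f c) {s : ℝ} (hs : 0 < s) :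
    ∫⁻ t in Ioc 0 s, rearr μ g t ≤ ∫⁻ t in Ioc 0 s, rearr μ f t := by
  refine (setLIntegral_rearr_le hg s (c := (rearr μ f s).toReal) ENNReal.toReal_nonneg).trans ?_
  refine le_trans ?_ (le_setLIntegral_rearr hf hs)
  rw [ENNReal.ofReal_toReal (rearr_lt_top hf hs).ne]
  gcongr
  exact h _ ENNReal.toReal_nonneg

/-- Pointwise, `(|f| - c)⁺` is at most `(|f| - c₀)⁺` plus `c₀⁺` on the set where `|f| > c`. -/
theorem finiteTails_of_meas {f : Ω →ₘ[μ] ℂ} {c₀ : ℝ} (h0 : tail μ f c₀ < ∞)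
    (h : ∀ c : ℝ, 0 < c → μ {ω | c < ‖f ω‖} < ∞) : FiniteTails μ f := by
  intro c hc
  have hle : tail μ f c ≤ tail μ f c₀ + ENNReal.ofReal c₀ * μ {ω | c < ‖f ω‖} := by
    rw [← lintegral_indicator_const (measurableSet_lt measurable_const (measurable_norm_coe f)),
      tail, tail, ← lintegral_add_left ((measurable_norm_coe f).sub_const c₀).ennreal_ofReal]
    refine lintegral_mono fun ω => ?_
    by_cases hω : c < ‖f ω‖
    · rw [indicator_of_mem (by exact hω)]
      refine le_trans (ENNReal.ofReal_le_ofReal ?_) ENNReal.ofReal_add_le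
      linarith
    · rw [ENNReal.ofReal_of_nonpos (by linarith)]
      exact zero_le
  exact hle.trans_lt (ENNReal.add_lt_top.2 ⟨h0, ENNReal.mul_lt_top ENNReal.ofReal_lt_top (h c hc)⟩)

theorem finiteTails_of_rearr {f : Ω →ₘ[μ] ℂ} (hf : f ∈ L0fin μ)
    (h1 : ∫⁻ t in Ioc 0 1, rearr μ f t < ∞)
    (h0 : ∀ c : ℝ, 0 < c → ∃ t : ℝ, rearr μ f t ≤ ENNReal.ofReal c) : FiniteTails μ f := by
  refine finiteTails_of_meas
    ((le_self_add.trans (le_setLIntegral_rearr hf one_pos)).trans_lt h1) fun c hc => ?_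
  obtain ⟨t, ht⟩ := h0 c hc
  rw [rearr_le_iff] at ht
  simp only [ofReal_lt_enorm_iff hc.le] at ht
  exact ht.trans_lt ENNReal.ofReal_lt_top

theorem rearrClass_smul (f : Ω →ₘ[μ] ℂ) {C : ℝ} (hC : 0 < C) :
    rearrClass μ ((C : ℂ) • f) = (C : ℂ) • rearrClass μ f := by
  refine AEEqFun.ext ?_
  filter_upwards [AEEqFun.coeFn_mk _ (rearr_aestronglyMeasurable μ f),
    AEEqFun.coeFn_mk _ (rearr_aestronglyMeasurable μ ((C : ℂ) • f)),
    AEEqFun.coeFn_smul (C : ℂ) (rearrClass μ f)] with t h1 h2 h3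
  rw [h3, Pi.smul_apply, rearrClass, h2, rearrClass, h1, rearr_smul f hC, ENNReal.toReal_mul,
    ENNReal.toReal_ofReal hC.le, Complex.ofReal_mul, smul_eq_mul]

end Rearrangement

/-! ### Fully symmetric, Marcinkiewicz and Orlicz spaces. -/

section Spaces

variable {Ω : Type*} [MeasurableSpace Ω] {μ : Measure Ω}

/-- If `f*` were not integrable at `0`, all its integrals over `(0, s]` would be infinite, so `2 f*`
would be submajorized by `f*`. Then `2 ‖f*‖ ≤ ‖f*‖`, so `f* = 0`, a contradiction. -/
theorem FullySymmetricSpace.setLIntegral_rearr_lt_top (E : FullySymmetricSpace) {f : Ω →ₘ[μ] ℂ}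
    (hf : f ∈ E.on μ) : ∫⁻ t in Ioc 0 1, rearr μ f t < ∞ := by
  by_contra hcon
  rw [not_lt, top_le_iff] at hcon
  have htop : ∀ s : ℝ, 0 < s → ∫⁻ t in Ioc 0 s, rearr μ f t = ∞ := by
    intro s hs
    by_contra hne
    have hle : ∫⁻ t in Ioc 0 1, rearr μ f t ≤
        (∫⁻ t in Ioc 0 s, rearr μ f t) + ∫⁻ _ in Ioc (0 : ℝ) 1, rearr μ f s := by
      rw [← lintegral_indicator measurableSet_Ioc, ← lintegral_indicator measurableSet_Ioc,
        ← lintegral_indicator measurableSet_Ioc, ← lintegral_add_right _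
          (measurable_const.indicator measurableSet_Ioc)]
      refine lintegral_mono fun t => ?_
      by_cases ht : t ∈ Ioc (0 : ℝ) 1
      · rw [indicator_of_mem ht, indicator_of_mem ht]
        by_cases hts : t ≤ s
        · rw [indicator_of_mem (show t ∈ Ioc 0 s from ⟨ht.1, hts⟩)]
          exact le_self_add
        · exact (rearr_antitone μ f (not_le.1 hts).le).trans le_add_self
      · rw [indicator_of_notMem ht]
        exact zero_le
    rw [hcon, lintegral_const, Measure.restrict_apply_univ, Real.volume_Ioc] at hle
    refine absurd (top_le_iff.1 hle) (ENNReal.add_ne_top.2 ⟨hne, ?_⟩)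
    exact ENNReal.mul_ne_top (rearr_lt_top hf.1 hs).ne ENNReal.ofReal_ne_top
  set F : E.carrier := ⟨rearrClass μ f, hf.2⟩ with hF
  have hsub : Submaj ((2 : ℂ) • F : E.carrier).1 F.1 := by
    intro s hs
    simp only [hF, rearr_rearrClass hf.1, htop s hs]
    exact le_top
  obtain ⟨h, hnorm⟩ := E.fully_symm F _ (E.subset_L0fin _ ((2 : ℂ) • F : E.carrier).2) hsub
  have h2 : E.norm ((2 : ℂ) • F) ≤ E.norm F := hnorm
  rw [map_smul_eq_mul, Complex.norm_ofNat] at h2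
  have h0 : E.norm F = 0 := le_antisymm (by linarith) (apply_nonneg _ _)
  have hz : rearrClass μ f = 0 := congrArg Subtype.val (E.eq_zero_of_norm F h0)
  have hae := enorm_rearrClass hf.1
  rw [hz] at hae
  have hnull : ∫⁻ t in Ioc 0 1, rearr μ f t = 0 := by
    rw [lintegral_eq_zero_iff (rearr_antitone μ f).measurable]
    have hsubset : Ioc (0 : ℝ) 1 ⊆ Ioi 0 := fun t ht => ht.1
    filter_upwards [ae_restrict_of_ae_restrict_of_subset hsubset hae,
      ae_restrict_of_ae_restrict_of_subset hsubset
        (AEEqFun.coeFn_zero (μ := halfLine) (β := ℂ))] with t h1 h2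
    rw [← h1, h2]
    simp
  rw [hnull] at hcon
  exact ENNReal.zero_ne_top hcon

/-- If `f*` stayed above `c`, the rearrangement of `1` would be at most `c⁻¹ f*`, which would put
`1` into the space. -/
theorem FullySymmetricSpace.exists_rearr_le (E : FullySymmetricSpace)
    (h1 : (1 : Ω →ₘ[μ] ℂ) ∉ E.on μ) {f : Ω →ₘ[μ] ℂ} (hf : f ∈ E.on μ) {c : ℝ} (hc : 0 < c) :
    ∃ t : ℝ, rearr μ f t ≤ ENNReal.ofReal c := by
  by_contra! hcon
  refine h1 ?_
  have hone : ∀ t, rearr μ (1 : Ω →ₘ[μ] ℂ) t ≤ 1 := by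
    intro t
    rw [rearr_le_iff]
    refine le_of_eq_of_le ?_ zero_le
    have : ∀ᵐ ω ∂μ, ¬ 1 < ‖(1 : Ω →ₘ[μ] ℂ) ω‖ₑ := by
      filter_upwards [AEEqFun.coeFn_one (α := Ω) (β := ℂ) (μ := μ)] with ω hω
      rw [hω]
      simp
    simpa [ae_iff] using this
  have h1L : (1 : Ω →ₘ[μ] ℂ) ∈ L0fin μ := by
    refine ⟨1, one_pos, ?_⟩
    have := rearr_le_iff.1 (hone 0)
    rw [← ENNReal.ofReal_one] at this
    simp only [ofReal_lt_enorm_iff zero_le_one] at this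
    exact this.trans_lt ENNReal.ofReal_lt_top
  refine ⟨h1L, ?_⟩
  have hsub : Submaj (rearrClass μ (1 : Ω →ₘ[μ] ℂ))
      (((c⁻¹ : ℝ) : ℂ) • (⟨rearrClass μ f, hf.2⟩ : E.carrier) : E.carrier).1 := by
    intro s _
    refine lintegral_mono fun t => ?_
    simp only [Submodule.coe_smul]
    rw [rearr_rearrClass h1L, rearr_smul _ (inv_pos.2 hc), rearr_rearrClass hf.1]
    refine (hone t).trans ?_
    calc (1 : ℝ≥0∞) = ENNReal.ofReal c⁻¹ * ENNReal.ofReal c := by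
          rw [← ENNReal.ofReal_mul (inv_pos.2 hc).le, inv_mul_cancel₀ hc.ne', ENNReal.ofReal_one]
      _ ≤ _ := by gcongr; exact (hcon t).le
  exact (E.fully_symm _ _ (rearrClass_mem_L0fin h1L) hsub).1

theorem FullySymmetricSpace.weightedErgodicTheoremHolds (E : FullySymmetricSpace)
    (h1 : (1 : Ω →ₘ[μ] ℂ) ∉ E.on μ) : WeightedErgodicTheoremHolds μ (E.on μ) := by
  have hX : ∀ f ∈ E.on μ, FiniteTails μ f := fun f hf =>
    finiteTails_of_rearr hf.1 (E.setLIntegral_rearr_lt_top hf) fun c hc =>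
      E.exists_rearr_le h1 hf hc
  refine weightedErgodicTheoremHolds_of hX ?_ ?_
  · intro f hf C hC
    refine ⟨((hX f hf).smul hC).mem_L0fin, ?_⟩
    rw [rearrClass_smul f hC]
    exact E.carrier.smul_mem _ hf.2
  · intro f hf g hg hgf
    refine ⟨hg.mem_L0fin, ?_⟩
    refine (E.fully_symm ⟨_, hf.2⟩ _ (rearrClass_mem_L0fin hg.mem_L0fin) fun s hs => ?_).1
    simp only [rearr_rearrClass hf.1, rearr_rearrClass hg.mem_L0fin]
    exact setLIntegral_rearr_mono hf.1 hg.mem_L0fin hgf hs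

theorem marcinkiewiczSpace_weightedErgodicTheoremHolds {φ : ℝ → ℝ}
    (hφ : Tendsto (fun t => φ t / t) atTop (𝓝 0)) :
    WeightedErgodicTheoremHolds μ (marcinkiewiczSpace μ φ) := by
  have hX : ∀ f ∈ marcinkiewiczSpace μ φ, FiniteTails μ f := by
    rintro f ⟨hf, hsup⟩
    lift (⨆ s : Ioi (0 : ℝ), (ENNReal.ofReal (φ s))⁻¹ * ∫⁻ t in Ioc 0 (s : ℝ), rearr μ f t)
      to NNReal using hsup.ne with K hK
    have hle : ∀ s : ℝ, 0 < s → ∫⁻ t in Ioc 0 s, rearr μ f t ≤ K * ENNReal.ofReal (φ s) := by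
      intro s hs
      have h1 : (ENNReal.ofReal (φ s))⁻¹ * ∫⁻ t in Ioc 0 s, rearr μ f t ≤ K := by
        rw [hK]
        exact le_iSup (fun s : Ioi (0 : ℝ) => (ENNReal.ofReal (φ s))⁻¹ *
          ∫⁻ t in Ioc 0 (s : ℝ), rearr μ f t) ⟨s, hs⟩
      -- Where `φ s = 0` the factor in the supremum is `∞`, so finiteness forces the integral to
      -- vanish.
      rcases eq_or_ne (ENNReal.ofReal (φ s)) 0 with h0 | h0
      · rw [h0, ENNReal.inv_zero] at h1
        rw [h0, mul_zero, nonpos_iff_eq_zero]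
        by_contra hne
        rw [ENNReal.top_mul hne] at h1
        exact ENNReal.coe_ne_top (top_le_iff.1 h1)
      · rwa [mul_comm, ← ENNReal.inv_mul_le_iff h0 ENNReal.ofReal_ne_top]
    refine finiteTails_of_rearr hf ((hle 1 one_pos).trans_lt
      (ENNReal.mul_lt_top ENNReal.coe_lt_top ENNReal.ofReal_lt_top)) fun c hc => ?_
    obtain ⟨s, hs, hs0⟩ := ((hφ.eventually (gt_mem_nhds (show 0 < c / (K + 1) by positivity))).and
      (eventually_gt_atTop 0)).exists
    refine ⟨s, ?_⟩
    -- Since `s f*(s) ≤ ∫₀ˢ f* ≤ K φ(s)`, smallness of `φ(s) / s` gives smallness of `f*(s)`.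
    have h1 := (le_add_self.trans (le_setLIntegral_rearr hf hs0)).trans (hle s hs0)
    have hs' : ENNReal.ofReal s ≠ 0 := by simpa using hs0
    rw [← ENNReal.le_div_iff_mul_le (Or.inl hs') (Or.inl ENNReal.ofReal_ne_top), mul_div_assoc,
      ← ENNReal.ofReal_div_of_pos hs0, ← ENNReal.ofReal_coe_nnreal,
      ← ENNReal.ofReal_mul K.coe_nonneg] at h1
    refine h1.trans (ENNReal.ofReal_le_ofReal ?_)
    have hK0 : (0 : ℝ) ≤ K := K.coe_nonneg
    rw [lt_div_iff₀ (by positivity)] at hs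
    rcases le_total 0 (φ s / s) with h | h <;> nlinarith
  refine weightedErgodicTheoremHolds_of hX ?_ ?_
  · intro f hf C hC
    refine ⟨((hX f hf).smul hC).mem_L0fin, ?_⟩
    have : ∀ s : Ioi (0 : ℝ), (ENNReal.ofReal (φ s))⁻¹ *
        ∫⁻ t in Ioc 0 (s : ℝ), rearr μ ((C : ℂ) • f) t = ENNReal.ofReal C *
        ((ENNReal.ofReal (φ s))⁻¹ * ∫⁻ t in Ioc 0 (s : ℝ), rearr μ f t) := by
      intro s
      simp only [rearr_smul f hC]
      rw [lintegral_const_mul' _ _ ENNReal.ofReal_ne_top]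
      ring
    simp only [this, ← ENNReal.mul_iSup]
    exact ENNReal.mul_lt_top ENNReal.ofReal_lt_top hf.2
  · intro f hf g hg hgf
    refine ⟨hg.mem_L0fin, lt_of_le_of_lt (iSup_mono fun s => ?_) hf.2⟩
    exact mul_le_mul' le_rfl (setLIntegral_rearr_mono hf.1 hg.mem_L0fin hgf s.2)

section Orlicz

variable {Φ : ℝ → ℝ}

theorem IsOrliczFunction.nonneg (hΦ : IsOrliczFunction Φ) {u : ℝ} (hu : 0 ≤ u) : 0 ≤ Φ u := by
  rcases hu.eq_or_lt with rfl | hu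
  · exact hΦ.zero.ge
  · exact (hΦ.pos u hu).le

theorem IsOrliczFunction.div_mono (hΦ : IsOrliczFunction Φ) {s t : ℝ} (hs : 0 < s) (hst : s ≤ t) :
    Φ s / s ≤ Φ t / t := by
  have ht : 0 < t := hs.trans_le hst
  have h := hΦ.convex.2 (mem_Ici.2 le_rfl) (mem_Ici.2 ht.le)
    (sub_nonneg.2 ((div_le_one ht).2 hst)) (div_nonneg hs.le ht.le) (by ring)
  simp only [smul_eq_mul, mul_zero, zero_add, hΦ.zero, div_mul_cancel₀ _ ht.ne'] at h
  rw [div_le_iff₀ hs]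
  exact h.trans (le_of_eq (by ring))

/-- Slopes of chords from the origin increase, so above height `c` the function `|f|` is at most a
constant multiple of `Φ(|f| / a)`. -/
theorem orliczSpace_finiteTails (hΦ : IsOrliczFunction Φ) {f : Ω →ₘ[μ] ℂ}
    (hf : f ∈ orliczSpace μ Φ) : FiniteTails μ f := by
  obtain ⟨-, a, ha, hfin⟩ := hf
  intro c hc
  have hac : 0 < a⁻¹ * c := by positivity
  have hpos := hΦ.pos _ hac
  refine lt_of_le_of_lt (b := ENNReal.ofReal (c / Φ (a⁻¹ * c)) *
    ∫⁻ ω, ENNReal.ofReal (Φ (a⁻¹ * ‖f ω‖)) ∂μ) ?_ (ENNReal.mul_lt_top ENNReal.ofReal_lt_top hfin)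
  rw [← lintegral_const_mul' _ _ ENNReal.ofReal_ne_top]
  refine lintegral_mono fun ω => ?_
  rw [← ENNReal.ofReal_mul (by positivity)]
  rcases le_total ‖f ω‖ c with h | h
  · rw [ENNReal.ofReal_of_nonpos (by linarith)]
    exact zero_le
  · refine ENNReal.ofReal_le_ofReal ?_
    have h1 := hΦ.div_mono hac (mul_le_mul_of_nonneg_left h (inv_pos.2 ha).le)
    have hf0 : 0 < ‖f ω‖ := hc.trans_le h
    rw [div_le_div_iff₀ hac (by positivity)] at h1
    have h2 : Φ (a⁻¹ * c) * ‖f ω‖ ≤ Φ (a⁻¹ * ‖f ω‖) * c := by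
      have hainv : 0 < a⁻¹ := inv_pos.2 ha
      nlinarith
    rw [div_mul_eq_mul_div, le_div_iff₀ hpos]
    nlinarith

theorem orliczSpace_weightedErgodicTheoremHolds (hΦ : IsOrliczFunction Φ) :
    WeightedErgodicTheoremHolds μ (orliczSpace μ Φ) := by
  refine weightedErgodicTheoremHolds_of (fun f hf => orliczSpace_finiteTails hΦ hf) ?_ ?_
  · intro f hf C hC
    refine ⟨((orliczSpace_finiteTails hΦ hf).smul hC).mem_L0fin, ?_⟩
    obtain ⟨-, a, ha, hfin⟩ := hf
    refine ⟨C * a, by positivity, lt_of_eq_of_lt (lintegral_congr_ae ?_) hfin⟩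
    filter_upwards [AEEqFun.coeFn_smul (C : ℂ) f] with ω hω
    rw [hω, Pi.smul_apply, norm_smul, Complex.norm_real, Real.norm_of_nonneg hC.le]
    congr 2
    field_simp
  · intro f hf g hg hgf
    obtain ⟨-, a, ha, hfin⟩ := hf
    have hainv : 0 < a⁻¹ := inv_pos.2 ha
    refine ⟨hg.mem_L0fin, 2 * a, by positivity, ?_⟩
    -- The increasing weight `Φ(t / a) / t` avoids derivatives of `Φ`. Its primitive lies between
    -- `Φ(u / (2a))`, from the interval `[u/2, u]` alone, and `Φ(u / a)`; hence the `2 * a`.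
    set w : ℝ → ℝ := fun t => Φ (a⁻¹ * t) / t with hw
    have hw0 : ∀ t, 0 ≤ t → 0 ≤ w t := fun t ht => div_nonneg (hΦ.nonneg (by positivity)) ht
    have hmono : MonotoneOn w (Ici 0) := by
      intro s hs t ht hst
      rcases (mem_Ici.1 hs).eq_or_lt with rfl | hs0
      · simpa [hw] using hw0 t ht
      · have h1 := hΦ.div_mono (mul_pos hainv hs0) (mul_le_mul_of_nonneg_left hst hainv.le)
        have ht0 : 0 < t := hs0.trans_le hst
        have e : ∀ r : ℝ, w r = a⁻¹ * (Φ (a⁻¹ * r) / (a⁻¹ * r)) := by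
          intro r
          simp only [hw]
          rw [← mul_div_assoc, mul_div_mul_left _ _ hainv.ne']
        rw [e, e]
        exact mul_le_mul_of_nonneg_left h1 hainv.le
    have hint : ∀ s t : ℝ, 0 ≤ s → s ≤ t → IntervalIntegrable w volume s t := by
      intro s t hs hst
      refine (hmono.mono ?_).intervalIntegrable
      rw [uIcc_of_le hst]
      exact fun r hr => hs.trans hr.1
    have hlow : ∀ u : ℝ, 0 ≤ u → Φ ((2 * a)⁻¹ * u) ≤ ∫ t in 0..u, w t := by
      intro u hu
      have hu2 : 0 ≤ u / 2 := by positivity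
      have h2 : ∫ t in (u / 2)..u, w (u / 2) ≤ ∫ t in (u / 2)..u, w t :=
        intervalIntegral.integral_mono_on (by linarith) intervalIntegrable_const
          (hint _ _ hu2 (by linarith)) fun t ht => hmono hu2 (hu2.trans ht.1) ht.1
      rw [intervalIntegral.integral_const, smul_eq_mul] at h2
      have h3 : 0 ≤ ∫ t in 0..(u / 2), w t :=
        intervalIntegral.integral_nonneg hu2 fun t ht => hw0 t ht.1
      rw [← intervalIntegral.integral_add_adjacent_intervals (hint 0 (u / 2) le_rfl hu2)
        (hint (u / 2) u hu2 (by linarith))]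
      have h4 : Φ ((2 * a)⁻¹ * u) = (u - u / 2) * w (u / 2) := by
        rcases hu.eq_or_lt with rfl | hu
        · simp [hΦ.zero]
        · simp only [hw]
          rw [show (2 * a)⁻¹ * u = a⁻¹ * (u / 2) by field_simp]
          field_simp
          ring
      linarith
    have hup : ∀ u : ℝ, 0 ≤ u → ∫ t in 0..u, w t ≤ Φ (a⁻¹ * u) := by
      intro u hu
      have h2 : ∫ t in 0..u, w t ≤ ∫ t in 0..u, w u :=
        intervalIntegral.integral_mono_on hu (hint _ _ le_rfl hu) intervalIntegrable_const
          fun t ht => hmono ht.1 hu ht.2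
      refine h2.trans (le_of_eq ?_)
      rw [intervalIntegral.integral_const, smul_eq_mul, sub_zero]
      rcases hu.eq_or_lt with rfl | hu
      · simp [hΦ.zero]
      · simp only [hw]
        field_simp
    calc ∫⁻ ω, ENNReal.ofReal (Φ ((2 * a)⁻¹ * ‖g ω‖)) ∂μ
        ≤ ∫⁻ ω, ENNReal.ofReal (∫ t in 0..‖g ω‖, w t) ∂μ :=
          lintegral_mono fun ω => ENNReal.ofReal_le_ofReal (hlow _ (norm_nonneg _))
      _ ≤ ∫⁻ ω, ENNReal.ofReal (∫ t in 0..‖f ω‖, w t) ∂μ :=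
          lintegral_primitive_le hgf (hmono.mono Ioi_subset_Ici_self) (fun t ht => hw0 t ht.le)
            fun t ht => hint 0 t le_rfl (le_of_lt ht)
      _ ≤ ∫⁻ ω, ENNReal.ofReal (Φ (a⁻¹ * ‖f ω‖)) ∂μ :=
          lintegral_mono fun ω => ENNReal.ofReal_le_ofReal (hup _ (norm_nonneg _))
      _ < ∞ := hfin

end Orlicz

end Spaces

/-! ### Lorentz spaces. -/

section LorentzSpaces

variable {Ω : Type*} [MeasurableSpace Ω] {μ : Measure Ω}

/-- The layer cake formula for functions with values in `[0, ∞]`. -/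
theorem lintegral_eq_lintegral_meas_ofReal_lt {α : Type*} [MeasurableSpace α] (m : Measure α)
    [SFinite m] {u : α → ℝ≥0∞} (hu : Measurable u) :
    ∫⁻ a, u a ∂m = ∫⁻ y in Ioi (0 : ℝ), m {a | ENNReal.ofReal y < u a} := by
  have hm : MeasurableSet {p : α × ℝ | ENNReal.ofReal p.2 < u p.1} :=
    measurableSet_lt (by fun_prop) (by fun_prop)
  calc ∫⁻ a, u a ∂m = ∫⁻ a, (∫⁻ y in Ioi (0 : ℝ),
      {p : α × ℝ | ENNReal.ofReal p.2 < u p.1}.indicator (fun _ => 1) (a, y)) ∂m := by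
        refine lintegral_congr fun a => ?_
        have : (fun y => {p : α × ℝ | ENNReal.ofReal p.2 < u p.1}.indicator
            (fun _ => (1 : ℝ≥0∞)) (a, y)) =
              {y : ℝ | ENNReal.ofReal y < u a}.indicator fun _ => 1 := rfl
        rw [this, lintegral_indicator_const (measurableSet_lt (by fun_prop) measurable_const),
          volume_setOf_ofReal_lt, one_mul]
    _ = ∫⁻ y in Ioi (0 : ℝ), ∫⁻ a,
          {p : α × ℝ | ENNReal.ofReal p.2 < u p.1}.indicator (fun _ => 1) (a, y) ∂m :=
        lintegral_lintegral_swap (measurable_const.indicator hm).aemeasurable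
    _ = _ := by
        refine lintegral_congr fun y => ?_
        rw [← one_mul (m _), ← lintegral_indicator_const (measurableSet_lt measurable_const hu)]
        rfl

section Lorentz

variable {φ : ℝ → ℝ}

theorem IsConcaveWeight.nonneg (h : IsConcaveWeight φ) {t : ℝ} (ht : 0 ≤ t) : 0 ≤ φ t :=
  h.zero ▸ h.mono (mem_Ici.2 le_rfl) (mem_Ici.2 ht) ht

/-- Take the right derivative of `φ`: concavity makes it a decreasing supergradient, and comparing
`x` with `x + 1` shows that it is nonnegative. -/
theorem IsConcaveWeight.exists_supergradient (h : IsConcaveWeight φ) :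
    ∃ q : ℝ → ℝ, AntitoneOn q (Ioi 0) ∧ (∀ x, 0 < x → 0 ≤ q x) ∧
      ∀ x y, 0 < x → 0 ≤ y → φ y ≤ φ x + q x * (y - x) := by
  have hconv := h.concave.neg
  have hint : interior (Ici (0 : ℝ)) = Ioi 0 := interior_Ici
  have hsup : ∀ x y, 0 < x → 0 ≤ y →
      φ y ≤ φ x + -derivWithin (-φ) (Ioi x) x * (y - x) := by
    intro x y hx hy
    have hx' : x ∈ interior (Ici (0 : ℝ)) := hint ▸ hx
    rcases lt_trichotomy x y with hxy | rfl | hxy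
    · have h1 := hconv.rightDeriv_le_slope_of_mem_interior hx' hy hxy
      rw [slope_def_field, le_div_iff₀ (sub_pos.2 hxy)] at h1
      simp only [Pi.neg_apply] at h1
      linarith
    · simp
    · have h1 := (hconv.slope_le_leftDeriv_of_mem_interior (mem_Ici.2 hy) hx' hxy).trans
        (hconv.leftDeriv_le_rightDeriv_of_mem_interior hx')
      rw [slope_def_field, div_le_iff₀ (sub_pos.2 hxy)] at h1
      simp only [Pi.neg_apply] at h1
      linarith
  refine ⟨fun x => -derivWithin (-φ) (Ioi x) x, ?_, ?_, hsup⟩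
  · intro x hx y hy hxy
    exact neg_le_neg (hconv.monotoneOn_rightDeriv (hint ▸ hx) (hint ▸ hy) hxy)
  · intro x hx
    have h1 := hsup x (x + 1) hx (by linarith)
    have h2 := h.mono (mem_Ici.2 hx.le) (mem_Ici.2 (by linarith : (0 : ℝ) ≤ x + 1)) (by linarith)
    linarith

instance (h : IsConcaveWeight φ) : SFinite h.measure := by
  unfold IsConcaveWeight.measure
  infer_instance

/-- Concavity makes `φ` continuous on `(0, ∞)`, so one-sided limits matter only at `0`; the atom
there is included in the ray. -/
theorem IsConcaveWeight.measure_Iio (h : IsConcaveWeight φ) {d : ℝ} (hd : 0 < d) :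
    h.measure (Iio d) = ENNReal.ofReal (φ d) := by
  have hcont : ∀ t : ℝ, 0 < t → ContinuousAt (fun t => φ (max t 0)) t := by
    intro t ht
    have h1 : ContinuousAt φ t := by
      have h2 : ConcaveOn ℝ (Ioi 0) φ := h.concave.subset Ioi_subset_Ici_self (convex_Ioi 0)
      exact (h2.continuousOn isOpen_Ioi).continuousAt (Ioi_mem_nhds ht)
    refine h1.congr ?_
    filter_upwards [Ioi_mem_nhds ht] with r hr
    rw [max_eq_left (le_of_lt hr)]
  have hpos : ∀ t : ℝ, 0 < t → h.monotone_extend.stieltjesFunction t = φ t := by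
    intro t ht
    rw [Monotone.stieltjesFunction_eq, (hcont t ht).continuousWithinAt.rightLim_eq,
      max_eq_left ht.le]
  have hneg : ∀ t : ℝ, t < 0 → h.monotone_extend.stieltjesFunction t = 0 := by
    intro t ht
    have hc : ContinuousAt (fun t => φ (max t 0)) t := by
      refine (continuousAt_const (y := φ 0)).congr ?_
      filter_upwards [Iio_mem_nhds ht] with r hr
      rw [max_eq_right (le_of_lt hr)]
    rw [Monotone.stieltjesFunction_eq, hc.continuousWithinAt.rightLim_eq, max_eq_right ht.le, h.zero]
  have hbot : Tendsto h.monotone_extend.stieltjesFunction atBot (𝓝 0) :=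
    tendsto_const_nhds.congr' ((eventually_lt_atBot 0).mono fun t ht => (hneg t ht).symm)
  have hleft : Function.leftLim h.monotone_extend.stieltjesFunction d = φ d := by
    refine leftLim_eq_of_tendsto ?_
    have h1 : Tendsto (fun t => φ (max t 0)) (𝓝[<] d) (𝓝 (φ (max d 0))) :=
      (hcont d hd).tendsto.mono_left nhdsWithin_le_nhds
    rw [max_eq_left hd.le] at h1
    refine h1.congr' ?_
    filter_upwards [mem_nhdsWithin_of_mem_nhds (Ioi_mem_nhds hd)] with t ht
    rw [hpos t ht, max_eq_left (le_of_lt ht)]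
  rw [IsConcaveWeight.measure, StieltjesFunction.measure_Iio _ hbot, hleft, sub_zero]

theorem IsConcaveWeight.measure_ofReal_lt (h : IsConcaveWeight φ) {d : ℝ≥0∞} (hd : d ≠ ∞) :
    h.measure {t | ENNReal.ofReal t < d} = ENNReal.ofReal (φ d.toReal) := by
  rcases eq_or_ne d 0 with rfl | h0
  · simp [h.zero]
  · have hpos : 0 < d.toReal := ENNReal.toReal_pos h0 hd
    rw [← h.measure_Iio hpos]
    congr 1
    ext t
    rw [mem_ofPred_eq, mem_Iio]
    rcases le_total 0 t with ht | ht
    · exact ENNReal.ofReal_lt_iff_lt_toReal ht hd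
    · rw [ENNReal.ofReal_of_nonpos ht]
      exact iff_of_true (pos_iff_ne_zero.2 h0) (ht.trans_lt hpos)

theorem lintegral_rearr_measure (h : IsConcaveWeight φ) (f : Ω →ₘ[μ] ℂ) :
    ∫⁻ t, rearr μ f t ∂h.measure =
      ∫⁻ y in Ioi (0 : ℝ), h.measure {t | ENNReal.ofReal t < μ {ω | y < ‖f ω‖}} := by
  rw [lintegral_eq_lintegral_meas_ofReal_lt _ (rearr_antitone μ f).measurable]
  refine setLIntegral_congr_fun measurableSet_Ioi fun y hy => ?_
  simp only [lt_rearr_iff, ofReal_lt_enorm_iff (le_of_lt hy)]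

/-- The Lorentz integral as the integral of `φ` of the distribution function, where concavity can be
used pointwise. -/
theorem FiniteTails.lintegral_rearr_measure {f : Ω →ₘ[μ] ℂ} (hf : FiniteTails μ f)
    (h : IsConcaveWeight φ) : ∫⁻ t, rearr μ f t ∂h.measure =
      ∫⁻ y in Ioi (0 : ℝ), ENNReal.ofReal (φ (μ {ω | y < ‖f ω‖}).toReal) := by
  rw [SymmErgodic.lintegral_rearr_measure]
  exact setLIntegral_congr_fun measurableSet_Ioi fun y hy =>
    h.measure_ofReal_lt (hf.meas_lt_top hy).ne

theorem lorentzSpace_finiteTails (h : IsConcaveWeight φ) (htop : Tendsto φ atTop atTop)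
    {f : Ω →ₘ[μ] ℂ} (hf : f ∈ lorentzSpace μ h) : FiniteTails μ f := by
  obtain ⟨hf0, hfin⟩ := hf
  have hmeas : ∀ c : ℝ, 0 < c → μ {ω | c < ‖f ω‖} < ∞ := by
    intro c hc
    by_contra hcon
    rw [not_lt, top_le_iff] at hcon
    have huniv : h.measure univ = ∞ := by
      refine ENNReal.eq_top_of_forall_nnreal_le fun r => ?_
      obtain ⟨d, hd, hd0⟩ := ((htop.eventually_ge_atTop (r : ℝ)).and (eventually_gt_atTop 0)).exists
      refine le_trans ?_ (measure_mono (subset_univ (Iio d)))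
      rw [h.measure_Iio hd0, ← ENNReal.ofReal_coe_nnreal]
      exact ENNReal.ofReal_le_ofReal hd
    have hle : ∀ t, ENNReal.ofReal c ≤ rearr μ f t := by
      intro t
      refine (lt_rearr_iff.2 ?_).le
      simp only [ofReal_lt_enorm_iff hc.le, hcon]
      exact ENNReal.ofReal_lt_top
    have h1 : ∫⁻ _, ENNReal.ofReal c ∂h.measure ≤ ∫⁻ t, rearr μ f t ∂h.measure := lintegral_mono hle
    rw [lintegral_const, huniv, ENNReal.mul_top (by simpa using hc)] at h1
    exact absurd hfin (not_lt.2 h1)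
  -- above the level `f*(1)` the distribution function is bounded by a multiple of `φ` of it
  have hφ1 : 0 < φ 1 := by
    obtain ⟨q, -, hq0, hq⟩ := h.exists_supergradient
    obtain ⟨t, ht, hφt⟩ := h.pos
    have h1 := hq 1 0 one_pos le_rfl
    have h2 := hq 1 t one_pos ht.le
    have h3 := hq0 1 one_pos
    rw [h.zero] at h1
    by_contra hcon
    have h4 : φ 1 = 0 := le_antisymm (not_lt.1 hcon) (h.nonneg zero_le_one)
    have h5 : q 1 = 0 := by linarith
    rw [h4, h5] at h2
    linarith
  have hlin : ∀ x, 0 ≤ x → x ≤ 1 → x * φ 1 ≤ φ x := by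
    intro x hx hx1
    have := h.concave.2 (mem_Ici.2 le_rfl) (mem_Ici.2 zero_le_one) (sub_nonneg.2 hx1) hx (by ring)
    simpa [h.zero] using this
  have hr1 := rearr_lt_top hf0 one_pos
  refine finiteTails_of_meas (c₀ := (rearr μ f 1).toReal) ?_ hmeas
  rw [SymmErgodic.lintegral_rearr_measure] at hfin
  rw [tail_eq_lintegral_distribution]
  refine lt_of_le_of_lt (b := ENNReal.ofReal (φ 1)⁻¹ * ∫⁻ y in Ioi (0 : ℝ),
    h.measure {t | ENNReal.ofReal t < μ {ω | y < ‖f ω‖}}) ?_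
    (ENNReal.mul_lt_top ENNReal.ofReal_lt_top hfin)
  rw [← lintegral_const_mul' _ _ ENNReal.ofReal_ne_top]
  refine le_trans (setLIntegral_mono' measurableSet_Ioi fun y hy => ?_)
    (lintegral_mono_set (Ioi_subset_Ioi ENNReal.toReal_nonneg))
  have hy0 : 0 < y := ENNReal.toReal_nonneg.trans_lt hy
  have hfy := hmeas y hy0
  have hle1 : μ {ω | y < ‖f ω‖} ≤ ENNReal.ofReal 1 := by
    have h1 : rearr μ f 1 ≤ ENNReal.ofReal y := by
      rw [← ENNReal.ofReal_toReal hr1.ne]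
      exact ENNReal.ofReal_le_ofReal (le_of_lt hy)
    rw [rearr_le_iff] at h1
    simpa only [ofReal_lt_enorm_iff hy0.le] using h1
  rw [h.measure_ofReal_lt hfy.ne, ← ENNReal.ofReal_mul (by positivity)]
  conv_lhs => rw [← ENNReal.ofReal_toReal hfy.ne]
  refine ENNReal.ofReal_le_ofReal ?_
  rw [inv_mul_eq_div, le_div_iff₀ hφ1]
  exact hlin _ ENNReal.toReal_nonneg (ENNReal.toReal_le_of_le_ofReal zero_le_one hle1)

/-- Tail domination implies domination of Lorentz integrals. -/
theorem lintegral_rearr_measure_mono (h : IsConcaveWeight φ) {f g : Ω →ₘ[μ] ℂ}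
    (hf : FiniteTails μ f) (hg : FiniteTails μ g)
    (hgf : ∀ c, 0 ≤ c → tail μ g c ≤ tail μ f c) (hfin : ∫⁻ t, rearr μ f t ∂h.measure < ∞) :
    ∫⁻ t, rearr μ g t ∂h.measure ≤ ∫⁻ t, rearr μ f t ∂h.measure := by
  rw [hf.lintegral_rearr_measure h] at hfin ⊢
  rw [hg.lintegral_rearr_measure h]
  obtain ⟨q, hq, hq0, hsup⟩ := h.exists_supergradient
  set A : ℝ → ℝ≥0∞ := fun y => μ {ω | y < ‖f ω‖} with hA
  set B : ℝ → ℝ≥0∞ := fun y => μ {ω | y < ‖g ω‖} with hB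
  have hAm : Measurable A := measurable_distribution f
  have hBm : Measurable B := measurable_distribution g
  have hAfin : ∀ y, 0 < y → A y ≠ ∞ := fun y hy => (hf.meas_lt_top hy).ne
  have hBfin : ∀ y, 0 < y → B y ≠ ∞ := fun y hy => (hg.meas_lt_top hy).ne
  have hanti : Antitone A := fun _ _ hst => measure_mono fun _ h => lt_of_le_of_lt hst h
  -- The supergradient of `φ` at the distribution function `A` of `f`, increasing since both are
  -- decreasing. The value `∞` where `A = 0` keeps it so, and is harmless because the distribution
  -- function `B` of `g` vanishes there too and `0 * ∞ = 0`.
  set w : ℝ → ℝ≥0∞ := fun y => if A y = 0 then ∞ else ENNReal.ofReal (q (A y).toReal) with hw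
  have hwmono : MonotoneOn w (Ioi 0) := by
    intro s hs t ht hst
    simp only [hw]
    by_cases htA : A t = 0
    · simp [htA]
    · have hsA : A s ≠ 0 := fun h0 => htA (nonpos_iff_eq_zero.1 (h0 ▸ hanti hst))
      rw [if_neg htA, if_neg hsA]
      exact ENNReal.ofReal_le_ofReal (hq (ENNReal.toReal_pos htA (hAfin t ht))
        (ENNReal.toReal_pos hsA (hAfin s hs)) (ENNReal.toReal_mono (hAfin s hs) (hanti hst)))
  have hwm : AEMeasurable w (volume.restrict (Ioi 0)) :=
    aemeasurable_restrict_of_monotoneOn measurableSet_Ioi hwmono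
  have hBA : ∀ y, 0 < y → A y = 0 → B y = 0 := by
    intro y hy hy0
    have h1 : tail μ f y = 0 := by
      rw [tail_eq_lintegral_distribution]
      refine le_antisymm ?_ zero_le
      refine (setLIntegral_mono' measurableSet_Ioi fun t ht => hanti (le_of_lt ht)).trans ?_
      rw [hy0]
      simp
    have h2 : tail μ g y = 0 := nonpos_iff_eq_zero.1 (h1 ▸ hgf y hy.le)
    rw [tail, lintegral_eq_zero_iff ((measurable_norm_coe g).sub_const y).ennreal_ofReal] at h2
    refine measure_mono_null (fun ω hω => ?_) (ae_iff.1 h2)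
    have hω' : y < ‖g ω‖ := hω
    simpa using hω'
  have hHardy : ∫⁻ y in Ioi 0, B y * w y ≤ ∫⁻ y in Ioi 0, A y * w y := by
    refine lintegral_mul_le_of_forall_Ioi hBm hAm hwmono fun c hc => ?_
    rw [← tail_eq_lintegral_distribution, ← tail_eq_lintegral_distribution]
    exact hgf c hc
  have hwA : ∀ y, 0 < y → A y * w y ≤ ENNReal.ofReal (φ (A y).toReal) := by
    intro y hy
    by_cases h0 : A y = 0
    · simp [h0]
    · have hpos := ENNReal.toReal_pos h0 (hAfin y hy)
      have h1 := hsup _ 0 hpos le_rfl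
      rw [h.zero] at h1
      simp only [hw, if_neg h0]
      nth_rewrite 1 [← ENNReal.ofReal_toReal (hAfin y hy)]
      rw [← ENNReal.ofReal_mul hpos.le]
      exact ENNReal.ofReal_le_ofReal (by linarith)
  -- The supergradient inequality at `A y` evaluated at `B y`, with the terms arranged so that no
  -- subtraction occurs in `[0, ∞]`.
  have hpt : ∀ y, 0 < y → ENNReal.ofReal (φ (B y).toReal) + A y * w y ≤
      ENNReal.ofReal (φ (A y).toReal) + B y * w y := by
    intro y hy
    by_cases h0 : A y = 0
    · simp [h0, hBA y hy h0]
    · have hpos := ENNReal.toReal_pos h0 (hAfin y hy)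
      have hB0 : 0 ≤ (B y).toReal := ENNReal.toReal_nonneg
      have hq' := hq0 _ hpos
      simp only [hw, if_neg h0]
      nth_rewrite 2 [← ENNReal.ofReal_toReal (hBfin y hy)]
      nth_rewrite 1 [← ENNReal.ofReal_toReal (hAfin y hy)]
      rw [← ENNReal.ofReal_mul hpos.le, ← ENNReal.ofReal_mul hB0,
        ← ENNReal.ofReal_add (h.nonneg hB0) (by positivity),
        ← ENNReal.ofReal_add (h.nonneg hpos.le) (by positivity)]
      exact ENNReal.ofReal_le_ofReal (by linarith [hsup _ _ hpos hB0])
  -- Since `φ(0) = 0`, the supergradient inequality at `0` bounds `A w` by `φ(A)`. Finiteness is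
  -- needed to cancel this integral after Hardy's lemma.
  have hfinA : ∫⁻ y in Ioi 0, A y * w y ≠ ∞ :=
    ((setLIntegral_mono' measurableSet_Ioi hwA).trans_lt hfin).ne
  refine (ENNReal.add_le_add_iff_right hfinA).1 ?_
  calc (∫⁻ y in Ioi (0 : ℝ), ENNReal.ofReal (φ (B y).toReal)) + ∫⁻ y in Ioi 0, A y * w y
      = ∫⁻ y in Ioi (0 : ℝ), (ENNReal.ofReal (φ (B y).toReal) + A y * w y) :=
        (lintegral_add_right' _ (hAm.aemeasurable.mul hwm)).symm
    _ ≤ ∫⁻ y in Ioi (0 : ℝ), (ENNReal.ofReal (φ (A y).toReal) + B y * w y) :=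
        setLIntegral_mono' measurableSet_Ioi hpt
    _ = (∫⁻ y in Ioi (0 : ℝ), ENNReal.ofReal (φ (A y).toReal)) + ∫⁻ y in Ioi 0, B y * w y :=
        lintegral_add_right' _ (hBm.aemeasurable.mul hwm)
    _ ≤ _ := by gcongr

theorem lorentzSpace_weightedErgodicTheoremHolds (h : IsConcaveWeight φ)
    (htop : Tendsto φ atTop atTop) : WeightedErgodicTheoremHolds μ (lorentzSpace μ h) := by
  have hX : ∀ f ∈ lorentzSpace μ h, FiniteTails μ f := fun f hf =>
    lorentzSpace_finiteTails h htop hf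
  refine weightedErgodicTheoremHolds_of hX ?_ ?_
  · intro f hf C hC
    refine ⟨((hX f hf).smul hC).mem_L0fin, ?_⟩
    simp only [rearr_smul f hC]
    rw [lintegral_const_mul' _ _ ENNReal.ofReal_ne_top]
    exact ENNReal.mul_lt_top ENNReal.ofReal_lt_top hf.2
  · intro f hf g hg hgf
    exact ⟨hg.mem_L0fin, (lintegral_rearr_measure_mono h (hX f hf) hg hgf hf.2).trans_lt hf.2⟩

end Lorentz

end LorentzSpaces

end SymmErgodic

theorem theorem6p1 {Ω : Type*} [MeasurableSpace Ω] (μ : Measure Ω) [SigmaFinite μ] :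
    (∀ E : SymmErgodic.FullySymmetricSpace, (1 : Ω →ₘ[μ] ℂ) ∉ E.on μ →
      SymmErgodic.WeightedErgodicTheoremHolds μ (E.on μ)) ∧
    (μ univ = ∞ →
      (∀ Φ : ℝ → ℝ, SymmErgodic.IsOrliczFunction Φ →
        SymmErgodic.WeightedErgodicTheoremHolds μ (SymmErgodic.orliczSpace μ Φ)) ∧
      (∀ (φ : ℝ → ℝ) (hφ : SymmErgodic.IsConcaveWeight φ), Tendsto φ atTop atTop →
        SymmErgodic.WeightedErgodicTheoremHolds μ (SymmErgodic.lorentzSpace μ hφ)) ∧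
      (∀ φ : ℝ → ℝ, SymmErgodic.IsConcaveWeight φ →
        Tendsto (fun t => φ t / t) atTop (𝓝 0) →
        SymmErgodic.WeightedErgodicTheoremHolds μ (SymmErgodic.marcinkiewiczSpace μ φ))) := by
  refine ⟨fun E h1 => E.weightedErgodicTheoremHolds h1, fun _ => ⟨fun Φ hΦ => ?_, ?_, ?_⟩⟩
  · exact SymmErgodic.orliczSpace_weightedErgodicTheoremHolds hΦ
  · exact fun φ hφ htop => SymmErgodic.lorentzSpace_weightedErgodicTheoremHolds hφ htop
  · exact fun φ _ hlim => SymmErgodic.marcinkiewiczSpace_weightedErgodicTheoremHolds hlim
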